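/- **Setting.** Let $A=(a_{ij})_{1\le i,j\le l}$ be a generalized Cartan matrix (integer entries, $a_{ii}=2$, $a_{ij}\le 0$ for $i\ne j$, and $a_{ij}=0\Rightarrow a_{ji}=0$). Let $(\mathfrak h,\{\alpha_i\},\{\alpha_i^\vee\})$ be a realization of $A$ over a field $\mathbb k$ of characteristic $0$: $\dim\mathfrak h=2l-\operatorname{rk}A$, and $\{\alpha_i\}\subset\mathfrak h^*$, $\{\alpha_i^\vee\}\subset\mathfrak h$ are linearly independent with $\alpha_j(\alpha_i^\vee)=a_{ij}$. The Weyl group $W\subset\operatorname{Aut}(\mathfrak h^*)$ is generated by the reflections $s_i(\varphi)=\varphi-\varphi(\alpha_i^\vee)\alpha_i$; the real roots are the elements $w(\alpha_i)$, $w\in W$. Let $\Lambda$ be a formal Demazure lattice, i.e. a finitely generated free subgroup of $\mathfrak h^*$ such that every simple root $\alpha_i$ can be extended to a $\mathbb Z$-basis of $\Lambda$ and $\lambda(\alpha_i^\vee)\in\mathbb Z$ for all $\lambda\in\Lambda$ and all $i$. Let $R$ be a commutative unital ring containing $\mathbb Z[t,t^{-1}]$, let $u\in R$, put $\mu_1=u(t+t^{-1})$,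 $\mu_2=-u^2$, and let $F(x,y)=\dfrac{x+y-\mu_1xy}{1+\mu_2xy}\in R[[x,y]]$ be the hyperbolic formal group law. The formal group algebra $R[[\Lambda]]_F$ is the quotient of the completion of $R[x_\lambda]_{\lambda\in\Lambda}$ at the kernel of the augmentation $x_\lambda\mapsto 0$ by the closure of the ideal generated by $x_0$ and all $x_{\lambda+\lambda'}-F(x_\lambda,x_{\lambda'})$. Let $Q^F$ be its localization at the multiplicative set generated by the $x_\alpha$, $\alpha$ a real root, with the action of $W$ induced by $w(x_\lambda)=x_{w(\lambda)}$, and let $Q^F_W=\bigoplus_{w\in W}Q^F\delta_w$ be the twisted group algebra, with product $(q\delta_v)(q'\delta_w)=q\,v(q')\,\delta_{vw}$. Put $X_i=\frac1{x_{\alpha_i}}(1-\delta_{s_i})$ for $1\le i\le l$, and let the formal Demazure algebra $\mathbf D_F$ be the $R$-subalgebra of $Q^F_W$ generated by $X_1,\dots,X_l$. Let $m_{ij}$ be the order of $s_is_j$ in $W$, and let $H$ be the Hecke algebra, the associative unital $R$-algebra generated by $T_1,\dots,T_l$ with relations $(T_i+t)(T_i-t^{-1})=0$ for all $i$ and $T_iT_jT_i\cdots=T_jT_iT_j\cdots$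 ($m_{ij}$ factors on each side) for all $i\ne j$ with $m_{ij}<\infty$. **Theorem.** There is a unique morphism of $R$-algebras $\mathbf D_F\to H$ with $X_i\mapsto u(T_i+t)$ for all $i$. If $u$ is a unit of $R$, this morphism is an isomorphism. -/

import Mathlib

noncomputable section

namespace FormalDemazure

/-! ### Kac-Moody data -/

/-- Generalized Cartan matrices. -/
structure IsGeneralizedCartanMatrix {l : ℕ} (A : Matrix (Fin l) (Fin l) ℤ) : Prop where
  diag : ∀ i, A i i = 2
  off_diag : ∀ i j, i ≠ j → A i j ≤ 0
  zero_symm : ∀ i j, A i j = 0 → A j i = 0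

/-- A realization `(𝔥, Π, Π^∨)` of a generalized Cartan matrix `A` of size `l` over a field `k`:
`dim 𝔥 = 2 l - rank A`, and the simple roots `α_j ∈ 𝔥^*` and simple coroots `α_i^∨ ∈ 𝔥`
form linearly independent families with `α_j (α_i^∨) = a_{ij}`. -/
structure KacMoodyRealization (k h : Type*) [Field k] [AddCommGroup h] [Module k h]
    {l : ℕ} (A : Matrix (Fin l) (Fin l) ℤ) where
  gcm : IsGeneralizedCartanMatrix A
  finite : Module.Finite k h
  finrank_add_rank : Module.finrank k h + (A.map (Int.cast : ℤ → k)).rank = 2 * l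
  root : Fin l → Module.Dual k h
  coroot : Fin l → h
  root_indep : LinearIndependent k root
  coroot_indep : LinearIndependent k coroot
  pairing : ∀ i j, root j (coroot i) = (A i j : k)

section KacMoody

variable {k h : Type*} [Field k] [AddCommGroup h] [Module k h]
  {l : ℕ} {A : Matrix (Fin l) (Fin l) ℤ} (D : KacMoodyRealization k h A)

namespace KacMoodyRealization

theorem root_coroot_self (i : Fin l) :
    Module.Dual.eval k h (D.coroot i) (D.root i) = 2 := by
  simp [D.pairing, D.gcm.diag]

/-- The simple reflection `s_i φ = φ - φ(α_i^∨) α_i` of `𝔥^*`. -/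
def simpleReflection (i : Fin l) : Module.Dual k h ≃ₗ[k] Module.Dual k h :=
  Module.reflection (D.root_coroot_self i)

theorem simpleReflection_apply (i : Fin l) (φ : Module.Dual k h) :
    D.simpleReflection i φ = φ - φ (D.coroot i) • D.root i := by
  simp [simpleReflection, Module.reflection_apply]

/-- The Weyl group, the subgroup of `Aut(𝔥^*)` generated by the simple reflections. -/
def weylGroup : Subgroup (Module.Dual k h ≃ₗ[k] Module.Dual k h) :=
  Subgroup.closure (Set.range D.simpleReflection)

/-- The simple reflection `s_i` as an element of the Weyl group. -/
def simpleRefl (i : Fin l) : D.weylGroup :=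
  ⟨D.simpleReflection i, Subgroup.subset_closure ⟨i, rfl⟩⟩

/-- The real roots: the elements `w(α_i)` for `w` in the Weyl group and `α_i` a simple root. -/
def realRoots : Set (Module.Dual k h) :=
  {α | ∃ (w : D.weylGroup) (i : Fin l), α = w.1 (D.root i)}

end KacMoodyRealization

/-- A formal Demazure lattice: a finitely generated free subgroup `Λ` of `𝔥^*` such that every
simple root can be extended to a `ℤ`-basis of `Λ` and `⟨Λ, α_i^∨⟩ ⊆ ℤ` for all `i`. -/
structure FormalDemazureLattice where
  carrier : AddSubgroup (Module.Dual k h)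
  finite : Module.Finite ℤ carrier
  free : Module.Free ℤ carrier
  exists_basis : ∀ i, ∃ (n : ℕ) (b : Module.Basis (Fin n) ℤ carrier) (m : Fin n),
    (b m : Module.Dual k h) = D.root i
  integral : ∀ φ ∈ carrier, ∀ i, ∃ c : ℤ, φ (D.coroot i) = (c : k)

namespace FormalDemazureLattice

variable {D} (L : FormalDemazureLattice D)

theorem root_mem (i : Fin l) : D.root i ∈ L.carrier := by
  obtain ⟨n, b, m, hb⟩ := L.exists_basis i
  exact hb ▸ (b m).2

/-- The simple root `α_i` as an element of the lattice. -/
def simpleRoot (i : Fin l) : L.carrier := ⟨D.root i, L.root_mem i⟩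

theorem weyl_mem (w : D.weylGroup) {φ : Module.Dual k h} (hφ : φ ∈ L.carrier) :
    w.1 φ ∈ L.carrier := by
  have key : ∀ (i : Fin l) (ψ : Module.Dual k h), ψ ∈ L.carrier →
      D.simpleReflection i ψ ∈ L.carrier := by
    intro i ψ hψ
    obtain ⟨c, hc⟩ := L.integral ψ hψ i
    have hz : (c : k) • D.root i = c • D.root i := Int.cast_smul_eq_zsmul k c (D.root i)
    have hr : D.simpleReflection i ψ = ψ - c • D.root i := by
      rw [← hz, ← hc, D.simpleReflection_apply]
    rw [hr]
    exact L.carrier.sub_mem hψ (L.carrier.zsmul_mem (L.root_mem i) c)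
  obtain ⟨w, hw⟩ := w
  change w φ ∈ L.carrier
  induction hw using Subgroup.closure_induction'' generalizing φ with
  | mem x hx => obtain ⟨i, rfl⟩ := hx; exact key i _ hφ
  | inv_mem x hx =>
    obtain ⟨i, rfl⟩ := hx
    have : (D.simpleReflection i)⁻¹ = D.simpleReflection i := by
      refine inv_eq_of_mul_eq_one_left (LinearEquiv.ext fun ψ => ?_)
      exact Module.involutive_reflection (D.root_coroot_self i) ψ
    rw [this]; exact key i _ hφ
  | one => exact hφ
  | mul x y _ _ hx hy => exact hx (hy hφ)

/-- The action of an element of the Weyl group on the lattice. -/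
def weylAct (w : D.weylGroup) : L.carrier →+ L.carrier where
  toFun φ := ⟨w.1 φ.1, L.weyl_mem w φ.2⟩
  map_zero' := by ext1; simp
  map_add' a b := by ext1; simp

theorem weylAct_one : L.weylAct 1 = AddMonoidHom.id _ := rfl

theorem weylAct_mul (v w : D.weylGroup) :
    L.weylAct (v * w) = (L.weylAct v).comp (L.weylAct w) := rfl

end FormalDemazureLattice

end KacMoody

/-! ### Formal group laws and formal group algebras -/

section FormalGroup

variable {R : Type*} [CommRing R]

/-- The hyperbolic formal group law
`F(x, y) = (x + y - μ₁ x y) / (1 + μ₂ x y)` in `R⟦x, y⟧`. -/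
def hyperbolicFGL (μ₁ μ₂ : R) : MvPowerSeries (Fin 2) R :=
  (MvPowerSeries.X 0 + MvPowerSeries.X 1
      - MvPowerSeries.C μ₁ * (MvPowerSeries.X 0 * MvPowerSeries.X 1)) *
    MvPowerSeries.invOfUnit
      (1 + MvPowerSeries.C μ₂ * (MvPowerSeries.X 0 * MvPowerSeries.X 1)) 1

variable (R) (M : Type*)

/-- The kernel of the augmentation `R[x_λ]_{λ ∈ M} → R`, `x_λ ↦ 0`. -/
def augIdeal : Ideal (MvPolynomial M R) :=
  RingHom.ker (MvPolynomial.constantCoeff (R := R) (σ := M))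

/-- The ring `R⟦x_λ⟧_{λ ∈ M}`, the completion of `R[x_λ]` at the augmentation ideal. -/
abbrev PowerSeriesCompletion : Type _ := AdicCompletion (augIdeal R M) (MvPolynomial M R)

variable {R M}

theorem X_mem_augIdeal (a : M) : (MvPolynomial.X a : MvPolynomial M R) ∈ augIdeal R M := by
  simp [augIdeal, RingHom.mem_ker]

/-- The indeterminate `x_a` in the completion. -/
def complX (a : M) : PowerSeriesCompletion R M :=
  AdicCompletion.of _ _ (MvPolynomial.X a)

variable (F : MvPowerSeries (Fin 2) R)

/-- The partial sums `∑_{i, j < n} c_{ij} x_a^i x_b^j` of `F(x_a, x_b) = ∑ c_{ij} x_a^i x_b^j`. -/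
def partialSum (a b : M) (n : ℕ) : MvPolynomial M R :=
  ∑ i ∈ Finset.range n, ∑ j ∈ Finset.range n,
    MvPolynomial.C (MvPowerSeries.coeff (Finsupp.single 0 i + Finsupp.single 1 j) F) *
      (MvPolynomial.X a ^ i * MvPolynomial.X b ^ j)

theorem partialSum_cauchy (a b : M) (n : ℕ) :
    partialSum F a b n ≡ partialSum F a b (n + 1)
      [SMOD (augIdeal R M ^ n • ⊤ : Submodule (MvPolynomial M R) (MvPolynomial M R))] := by
  have ha := Ideal.pow_mem_pow (X_mem_augIdeal (R := R) a) n
  have hb := Ideal.pow_mem_pow (X_mem_augIdeal (R := R) b) n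
  rw [SModEq.comm, SModEq.sub_mem, smul_eq_mul, Ideal.mul_top]
  unfold partialSum
  rw [Finset.sum_range_succ]
  simp_rw [Finset.sum_range_succ _ n]
  rw [Finset.sum_add_distrib, add_assoc, add_sub_cancel_left]
  refine add_mem (sum_mem fun i _ => ?_) (add_mem (sum_mem fun j _ => ?_) ?_)
  · exact Ideal.mul_mem_left _ _ (Ideal.mul_mem_left _ _ hb)
  · exact Ideal.mul_mem_left _ _ (Ideal.mul_mem_right _ _ ha)
  · exact Ideal.mul_mem_left _ _ (Ideal.mul_mem_left _ _ hb)

/-- `F(x_a, x_b)` in the completion, as the limit of the partial sums. -/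
def fglEval (a b : M) : PowerSeriesCompletion R M :=
  AdicCompletion.mk _ _ (AdicCompletion.AdicCauchySequence.mk _ _ (partialSum F a b)
    (partialSum_cauchy F a b))

end FormalGroup

section FormalGroupAlgebra

variable {R : Type*} [CommRing R] (M : Type*) [AddCommGroup M] (F : MvPowerSeries (Fin 2) R)

/-- The ideal generated by `x_0` and by `x_{a+b} - F(x_a, x_b)` for all `a, b`. -/
def fglIdeal : Ideal (PowerSeriesCompletion R M) :=
  Ideal.span ({complX 0} ∪ Set.range fun p : M × M => complX (p.1 + p.2) - fglEval F p.1 p.2)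

/-- The closure of `fglIdeal` in the topology of the completion, in which the kernels of the
projections to `R[x_λ] / (ker ε)^n` form a basis of neighbourhoods of zero. -/
def fglIdealClosure : Ideal (PowerSeriesCompletion R M) :=
  ⨅ n : ℕ, fglIdeal M F ⊔ RingHom.ker (AdicCompletion.evalₐ (augIdeal R M) n)

/-- The formal group algebra `R⟦M⟧_F`. -/
def FormalGroupAlgebra : Type _ := PowerSeriesCompletion R M ⧸ fglIdealClosure M F

instance : CommRing (FormalGroupAlgebra M F) :=
  inferInstanceAs (CommRing (PowerSeriesCompletion R M ⧸ fglIdealClosure M F))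

instance : Algebra R (FormalGroupAlgebra M F) :=
  inferInstanceAs (Algebra R (PowerSeriesCompletion R M ⧸ fglIdealClosure M F))

variable {M}

/-- The element `x_a` of the formal group algebra. -/
def xElt (a : M) : FormalGroupAlgebra M F := Ideal.Quotient.mk (fglIdealClosure M F) (complX a)

/-! Functoriality of the formal group algebra in the abelian group. -/

variable {N : Type*} [AddCommGroup N]

theorem augIdeal_pow_le (f : M →+ N) (n : ℕ) :
    augIdeal R M ^ n ≤ (augIdeal R N ^ n).comap (MvPolynomial.rename (R := R) f) := by
  rw [← Ideal.map_le_iff_le_comap, Ideal.map_pow]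
  refine Ideal.pow_right_mono ?_ n
  rw [Ideal.map_le_iff_le_comap]
  intro p hp
  simpa [augIdeal, RingHom.mem_ker, MvPolynomial.constantCoeff_rename] using hp

/-- The map induced by `f` modulo the `n`-th power of the augmentation ideal. -/
def quotMap (f : M →+ N) (n : ℕ) :
    (MvPolynomial M R ⧸ augIdeal R M ^ n) →ₐ[R] (MvPolynomial N R ⧸ augIdeal R N ^ n) :=
  Ideal.quotientMapₐ _ (MvPolynomial.rename f) (augIdeal_pow_le f n)

theorem quotMap_mk (f : M →+ N) (n : ℕ) (p : MvPolynomial M R) :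
    quotMap f n (Ideal.Quotient.mk _ p) = Ideal.Quotient.mk _ (MvPolynomial.rename f p) := rfl

theorem quotMap_compat (f : M →+ N) {m n : ℕ} (hmn : m ≤ n) :
    (Ideal.Quotient.factorₐ R (Ideal.pow_le_pow_right (I := augIdeal R N) hmn)).comp
        ((quotMap f n).comp ((AdicCompletion.evalₐ (augIdeal R M) n).restrictScalars R)) =
      (quotMap f m).comp ((AdicCompletion.evalₐ (augIdeal R M) m).restrictScalars R) := by
  refine AlgHom.ext fun x => ?_
  obtain ⟨x, rfl⟩ := AdicCompletion.mk_surjective (augIdeal R M) (MvPolynomial M R) x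
  simp only [AlgHom.comp_apply, AlgHom.restrictScalars_apply, AdicCompletion.evalₐ_mk,
    quotMap_mk]
  exact congrArg (quotMap f m) (AdicCompletion.Ideal.mk_eq_mk (augIdeal R M) hmn x)

/-- The algebra map of completions induced by `x_a ↦ x_{f(a)}`. -/
def complMap (f : M →+ N) : PowerSeriesCompletion R M →ₐ[R] PowerSeriesCompletion R N :=
  AdicCompletion.liftAlgHom (augIdeal R N)
    (fun n => (quotMap f n).comp ((AdicCompletion.evalₐ (augIdeal R M) n).restrictScalars R))
    (quotMap_compat f)

theorem evalₐ_complMap (f : M →+ N) (n : ℕ) (x : PowerSeriesCompletion R M) :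
    AdicCompletion.evalₐ (augIdeal R N) n (complMap f x) =
      quotMap f n (AdicCompletion.evalₐ (augIdeal R M) n x) :=
  AdicCompletion.evalₐ_liftAlgHom (augIdeal R N)
    (fun n => (quotMap f n).comp ((AdicCompletion.evalₐ (augIdeal R M) n).restrictScalars R))
    (quotMap_compat f) n x

theorem complMap_complX (f : M →+ N) (a : M) :
    complMap f (complX a : PowerSeriesCompletion R M) = complX (f a) := by
  refine AdicCompletion.ext_evalₐ fun n => ?_
  simp [evalₐ_complMap, complX, quotMap_mk]

theorem complMap_fglEval (f : M →+ N) (a b : M) :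
    complMap f (fglEval F a b) = fglEval F (f a) (f b) := by
  refine AdicCompletion.ext_evalₐ fun n => ?_
  simp [evalₐ_complMap, fglEval, quotMap_mk, partialSum]

theorem complMap_id :
    complMap (AddMonoidHom.id M) = AlgHom.id R (PowerSeriesCompletion R M) := by
  refine AlgHom.ext fun x => ?_
  obtain ⟨x, rfl⟩ := AdicCompletion.mk_surjective (augIdeal R M) (MvPolynomial M R) x
  refine AdicCompletion.ext_evalₐ fun n => ?_
  simp [evalₐ_complMap, quotMap_mk]

theorem complMap_comp {P : Type*} [AddCommGroup P] (g : N →+ P) (f : M →+ N) :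
    (complMap (g.comp f) : PowerSeriesCompletion R M →ₐ[R] PowerSeriesCompletion R P) =
      (complMap g).comp (complMap f) := by
  refine AlgHom.ext fun x => ?_
  obtain ⟨x, rfl⟩ := AdicCompletion.mk_surjective (augIdeal R M) (MvPolynomial M R) x
  refine AdicCompletion.ext_evalₐ fun n => ?_
  simp [evalₐ_complMap, quotMap_mk, MvPolynomial.rename_rename]

theorem fglIdealClosure_le (f : M →+ N) :
    fglIdealClosure M F ≤ (fglIdealClosure N F).comap (complMap f) := by
  intro x hx
  simp only [fglIdealClosure, Ideal.mem_comap, Submodule.mem_iInf] at hx ⊢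
  intro n
  have h : fglIdeal M F ⊔ RingHom.ker (AdicCompletion.evalₐ (augIdeal R M) n) ≤
      (fglIdeal N F ⊔ RingHom.ker (AdicCompletion.evalₐ (augIdeal R N) n)).comap
        (complMap f) := by
    refine sup_le ?_ ?_
    · refine le_trans ?_ (Ideal.comap_mono le_sup_left)
      refine Ideal.span_le.2 ?_
      rintro _ (h | ⟨p, rfl⟩)
      · rw [Set.mem_singleton_iff] at h
        subst h
        simp only [SetLike.mem_coe, Ideal.mem_comap, complMap_complX, map_zero]
        exact Ideal.subset_span (Or.inl rfl)
      · simp only [SetLike.mem_coe, Ideal.mem_comap, map_sub, complMap_complX, map_add,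
          complMap_fglEval]
        exact Ideal.subset_span (Or.inr ⟨(f p.1, f p.2), rfl⟩)
    · refine le_trans ?_ (Ideal.comap_mono le_sup_right)
      intro y hy
      rw [RingHom.mem_ker] at hy
      rw [Ideal.mem_comap, RingHom.mem_ker, evalₐ_complMap, hy, map_zero]
  exact h (hx n)

/-- The algebra map `R⟦M⟧_F → R⟦N⟧_F`, `x_a ↦ x_{f(a)}`, induced by `f : M → N`. -/
def fgaMap (f : M →+ N) : FormalGroupAlgebra M F →ₐ[R] FormalGroupAlgebra N F :=
  Ideal.quotientMapₐ (fglIdealClosure N F) (complMap f) (fglIdealClosure_le F f)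

theorem fgaMap_xElt (f : M →+ N) (a : M) : fgaMap F f (xElt F a) = xElt F (f a) :=
  congrArg (Ideal.Quotient.mk (fglIdealClosure N F)) (complMap_complX f a)

theorem fgaMap_id (x : FormalGroupAlgebra M F) : fgaMap F (AddMonoidHom.id M) x = x := by
  obtain ⟨x, rfl⟩ := Ideal.Quotient.mk_surjective x
  exact congrArg (Ideal.Quotient.mk (fglIdealClosure M F)) (by rw [complMap_id]; rfl)

theorem fgaMap_comp {P : Type*} [AddCommGroup P] (g : N →+ P) (f : M →+ N)
    (x : FormalGroupAlgebra M F) : fgaMap F (g.comp f) x = fgaMap F g (fgaMap F f x) := by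
  obtain ⟨x, rfl⟩ := Ideal.Quotient.mk_surjective x
  exact congrArg (Ideal.Quotient.mk (fglIdealClosure P F)) (by rw [complMap_comp]; rfl)

end FormalGroupAlgebra

/-! ### The twisted formal group algebra and the formal Demazure algebra -/

section Demazure

variable {k h : Type*} [Field k] [AddCommGroup h] [Module k h]
  {l : ℕ} {A : Matrix (Fin l) (Fin l) ℤ} {D : KacMoodyRealization k h A}
  (L : FormalDemazureLattice D) {R : Type*} [CommRing R] (F : MvPowerSeries (Fin 2) R)

/-- The multiplicative subset of `R⟦Λ⟧_F` generated by the `x_α` for `α` a real root. -/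
def rootSubmonoid : Submonoid (FormalGroupAlgebra L.carrier F) :=
  Submonoid.closure {y | ∃ a : L.carrier, (a : Module.Dual k h) ∈ D.realRoots ∧ y = xElt F a}

theorem xElt_simpleRoot_mem (i : Fin l) : xElt F (L.simpleRoot i) ∈ rootSubmonoid L F :=
  Submonoid.subset_closure ⟨_, ⟨1, i, rfl⟩, rfl⟩

/-- The ring `Q^F`, the localization of `R⟦Λ⟧_F` at all `x_α` with `α` a real root. -/
def QF : Type _ := Localization (rootSubmonoid L F)

instance : CommRing (QF L F) := inferInstanceAs (CommRing (Localization (rootSubmonoid L F)))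

instance : Algebra (FormalGroupAlgebra L.carrier F) (QF L F) :=
  inferInstanceAs (Algebra _ (Localization (rootSubmonoid L F)))

instance : IsLocalization (rootSubmonoid L F) (QF L F) :=
  inferInstanceAs (IsLocalization _ (Localization (rootSubmonoid L F)))

instance : Algebra R (QF L F) := inferInstanceAs (Algebra R (Localization (rootSubmonoid L F)))

instance : IsScalarTower R (FormalGroupAlgebra L.carrier F) (QF L F) :=
  inferInstanceAs (IsScalarTower R _ (Localization (rootSubmonoid L F)))

theorem rootSubmonoid_le (w : D.weylGroup) :
    rootSubmonoid L F ≤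
      (rootSubmonoid L F).comap (fgaMap F (L.weylAct w)).toRingHom := by
  refine Submonoid.closure_le.2 ?_
  rintro _ ⟨a, ⟨v, i, hv⟩, rfl⟩
  refine Submonoid.subset_closure ⟨L.weylAct w a, ⟨w * v, i, ?_⟩, ?_⟩
  · change w.1 a.1 = w.1 (v.1 (D.root i))
    rw [hv]
  · exact fgaMap_xElt F _ a

/-- The automorphism of `Q^F` induced by `x_a ↦ x_{w(a)}`. -/
def weylQF (w : D.weylGroup) : QF L F →+* QF L F :=
  IsLocalization.map (M := rootSubmonoid L F) (T := rootSubmonoid L F) (QF L F)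
    (fgaMap F (L.weylAct w)).toRingHom
    (rootSubmonoid_le L F w)

theorem weylQF_algebraMap (w : D.weylGroup) (x : FormalGroupAlgebra L.carrier F) :
    weylQF L F w (algebraMap _ (QF L F) x) = algebraMap _ _ (fgaMap F (L.weylAct w) x) :=
  IsLocalization.map_eq _ x

theorem weylQF_one : weylQF L F 1 = RingHom.id _ := by
  refine IsLocalization.ringHom_ext (rootSubmonoid L F) (RingHom.ext fun x => ?_)
  simp only [RingHom.comp_apply, weylQF_algebraMap, L.weylAct_one, fgaMap_id, RingHom.id_apply]

theorem weylQF_mul (v w : D.weylGroup) :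
    weylQF L F (v * w) = (weylQF L F v).comp (weylQF L F w) := by
  refine IsLocalization.ringHom_ext (rootSubmonoid L F) (RingHom.ext fun x => ?_)
  simp only [RingHom.comp_apply, weylQF_algebraMap, L.weylAct_mul, fgaMap_comp]

/-- The action of the Weyl group on `Q^F`. -/
instance : MulSemiringAction D.weylGroup (QF L F) where
  smul w x := weylQF L F w x
  one_smul x := by change weylQF L F 1 x = x; rw [weylQF_one]; rfl
  mul_smul v w x := by
    change weylQF L F (v * w) x = weylQF L F v (weylQF L F w x)
    rw [weylQF_mul]; rfl
  smul_zero w := map_zero (weylQF L F w)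
  smul_add w := map_add (weylQF L F w)
  smul_one w := map_one (weylQF L F w)
  smul_mul w := map_mul (weylQF L F w)

instance : SMulCommClass D.weylGroup R (QF L F) where
  smul_comm w r x := by
    change weylQF L F w (r • x) = r • weylQF L F w x
    rw [Algebra.smul_def, Algebra.smul_def, map_mul,
      IsScalarTower.algebraMap_apply R (FormalGroupAlgebra L.carrier F) (QF L F),
      weylQF_algebraMap, AlgHom.commutes]

/-- The twisted formal group algebra `Q^F_W`: the free left `Q^F`-module on the symbols `δ_w`
(`δ_w` is `SkewMonoidAlgebra.single w 1`) with `(q δ_v) (q' δ_w) = q v(q') δ_{vw}`; equivalently,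
`(δ_v q) (δ_w q') = δ_{vw} w⁻¹(q) q'`. -/
abbrev TwistedAlgebra : Type _ := SkewMonoidAlgebra (QF L F) D.weylGroup

/-- The element `1 / x_{α_i}` of `Q^F`. -/
def invSimpleRoot (i : Fin l) : QF L F :=
  IsLocalization.mk' (QF L F) 1
    (⟨xElt F (L.simpleRoot i), xElt_simpleRoot_mem L F i⟩ : rootSubmonoid L F)

/-- The formal Demazure element `X_i = (1 / x_{α_i}) (1 - δ_{s_i})`. -/
def demazureElement (i : Fin l) : TwistedAlgebra L F :=
  SkewMonoidAlgebra.single 1 (invSimpleRoot L F i) *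
    (1 - SkewMonoidAlgebra.single (D.simpleRefl i) 1)

/-- The formal Demazure algebra `D_F`: the `R`-subalgebra of `Q^F_W` generated by the formal
Demazure elements `X_i`. -/
def formalDemazureAlgebra : Subalgebra R (TwistedAlgebra L F) :=
  Algebra.adjoin R (Set.range (demazureElement L F))

/-- The generator `X_i` of `D_F`. -/
def demazureGen (i : Fin l) : formalDemazureAlgebra L F :=
  ⟨demazureElement L F i, Algebra.subset_adjoin ⟨i, rfl⟩⟩

end Demazure

/-! ### The Hecke algebra -/

section Hecke

variable {k h : Type*} [Field k] [AddCommGroup h] [Module k h]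
  {l : ℕ} {A : Matrix (Fin l) (Fin l) ℤ} (D : KacMoodyRealization k h A)
  (R : Type*) [CommRing R] [Algebra (LaurentPolynomial ℤ) R]

/-- The element `t` of a `ℤ[t, t⁻¹]`-algebra. -/
def tElt : R := algebraMap (LaurentPolynomial ℤ) R (LaurentPolynomial.T 1)

/-- The element `t⁻¹` of a `ℤ[t, t⁻¹]`-algebra. -/
def tInv : R := algebraMap (LaurentPolynomial ℤ) R (LaurentPolynomial.T (-1))

/-- The alternating product `a b a ⋯` with `n` factors. -/
def altProd {B : Type*} [Monoid B] : ℕ → B → B → B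
  | 0, _, _ => 1
  | n + 1, a, b => a * altProd n b a

/-- The defining relations of the Hecke algebra: the quadratic relations
`(T_i + t) (T_i - t⁻¹) = 0` and the braid relations `T_i T_j T_i ⋯ = T_j T_i T_j ⋯` with `m_{ij}`
factors, where `m_{ij}` is the order of `s_i s_j` in the Weyl group, for `i ≠ j` with `m_{ij}`
finite (`orderOf` is zero for elements of infinite order). -/
inductive HeckeRel : FreeAlgebra R (Fin l) → FreeAlgebra R (Fin l) → Prop
  | quadratic (i : Fin l) :
      HeckeRel ((FreeAlgebra.ι R i + algebraMap R _ (tElt R)) *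
        (FreeAlgebra.ι R i - algebraMap R _ (tInv R))) 0
  | braid (i j : Fin l) (hij : i ≠ j) (hm : orderOf (D.simpleRefl i * D.simpleRefl j) ≠ 0) :
      HeckeRel
        (altProd (orderOf (D.simpleRefl i * D.simpleRefl j)) (FreeAlgebra.ι R i)
          (FreeAlgebra.ι R j))
        (altProd (orderOf (D.simpleRefl i * D.simpleRefl j)) (FreeAlgebra.ι R j)
          (FreeAlgebra.ι R i))

/-- The Hecke algebra `H` over `R` of the Weyl group. -/
abbrev HeckeAlgebra : Type _ := RingQuot (HeckeRel D R)

/-- The generator `T_i` of the Hecke algebra. -/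
def heckeT (i : Fin l) : HeckeAlgebra D R :=
  RingQuot.mkAlgHom R (HeckeRel D R) (FreeAlgebra.ι R i)

end Hecke

end FormalDemazure

end

/-!
The comparison map is found through its graph, the subalgebra `E` of `Q^F_W × H` generated by the
pairs `z_i = (X_i, u (T_i + t))`. Its first projection is onto `D_F`, so a map `D_F → H` with
`X_i ↦ u (T_i + t)` exists if that projection is injective on `E`. Two facts give this.

* The `z_i` satisfy `z_i ^ 2 = μ₁ z_i`, and they satisfy the braid relations up to products of
  fewer factors. By the argument of Matsumoto's theorem (`QuasiBraid.prod_sub_prod_mem`), `E` is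
  then spanned over `R` by the products of the `z_i` along one reduced word for each `w ∈ W`
  (`QuasiBraid.adjoin_le_span`).
* The corresponding products of the `X_i` in `Q^F_W` are linearly independent over `R`
  (`linearIndependent_demazure`): they are triangular with respect to the `δ_w`, with units of
  `Q^F` on the diagonal, and `R` embeds into `Q^F` (`injective_algebraMap_QF`). For the latter, a
  homomorphism from the lattice to the points of the formal group law in a power series ring
  specializes each `x_λ` to a series with linear coefficient `λ`, which is regular if `λ` is a
  real root.

The corrected braid relations have a closed form which both factors share. Put
`C_0(a, b) = 0`, `C_1(a, b) = a` and `C_{k+2}(a, b) = a C_{k+1}(b, a) + μ₂ C_k(a, b)`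
(`klProd μ₂`); then `C_m(z_i, z_j) = C_m(z_j, z_i)` where `m` is the order of `s_i s_j`. In the
Hecke algebra, up to the factor `u ^ m`, both sides are the Kazhdan-Lusztig element
`∑ t ^ (m - ℓ v) T_v` of the dihedral subgroup (`klProd_add_scalar`). In `Q^F_W`, both sides are
`(∏ 1 / x_β) ∑ (-1) ^ ℓ(v) δ_v`, with the product over the positive roots `β` of the rank two
subsystem. This is checked for each of the types `A₁ × A₁`, `A₂`, `B₂`, `G₂`, which are the only
ones with `m` finite; beyond the action of the two reflections on the `1 / x_β`, the check uses
only the formal group law, in the form `p_α p_β + μ₂ = p_{α+β} (p_α + p_β - μ₁)` for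
`p_β = 1 / x_β` (`invRoot_add`).

If `u` is a unit, the same symmetry in `Q^F_W`, read backwards, shows that the `u⁻¹ X_i - t`
satisfy the relations of `H`. This gives a map `H → Q^F_W` whose composite with the comparison map
is the inclusion of `D_F`.
-/

noncomputable section

namespace FormalDemazure

/-! ### Alternating products with Chebyshev corrections -/

section KLProd

variable {R B : Type*} [CommRing R] [Ring B] [Algebra R B]

/-- Alternating products with lower order terms: `C_0 = 0`, `C_1(a, b) = a` and
`C_{k+2}(a, b) = a C_{k+1}(b, a) + n C_k(a, b)`. For `n = -1` this is the recursion for the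
Kazhdan-Lusztig elements of a dihedral group. -/
def klProd (n : R) : ℕ → B → B → B
  | 0, _, _ => 0
  | 1, a, _ => a
  | k + 2, a, b => a * klProd n (k + 1) b a + n • klProd n k a b

theorem klProd_zero (n : R) (a b : B) : klProd n 0 a b = 0 := rfl

theorem klProd_add_two (n : R) (k : ℕ) (a b : B) :
    klProd n (k + 2) a b = a * klProd n (k + 1) b a + n • klProd n k a b := rfl

theorem altProd_succ {B : Type*} [Monoid B] (k : ℕ) (a b : B) :
    altProd (k + 1) a b = a * altProd k b a := rfl

theorem klProd_map {C : Type*} [Ring C] [Algebra R C] (f : B →ₐ[R] C) (n : R) :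
    ∀ (k : ℕ) (a b : B), f (klProd n k a b) = klProd n k (f a) (f b)
  | 0, _, _ => by simp [klProd]
  | 1, _, _ => by simp [klProd]
  | k + 2, a, b => by simp [klProd, klProd_map f n (k + 1), klProd_map f n k]

theorem klProd_smul (u n : R) :
    ∀ (k : ℕ) (a b : B), klProd (u ^ 2 * n) k (u • a) (u • b) = u ^ k • klProd n k a b
  | 0, _, _ => by simp [klProd]
  | 1, _, _ => by simp [klProd]
  | k + 2, a, b => by
    rw [klProd, klProd, klProd_smul u n (k + 1), klProd_smul u n k, smul_mul_smul_comm, smul_add,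
      smul_smul, smul_smul]
    congr 2 <;> ring

/-- The sum of `t ^ (k - r)` times the alternating products of `r` factors `a` and `b`, over all
`r < k`. There are two such products for each `0 < r < k`, and one for `r = 0`. The value for
`k = 0` is zero. -/
def heckeTail (t : R) (a b : B) : ℕ → B
  | 0 => 0
  | 1 => t • 1
  | k + 2 => t • (heckeTail t a b (k + 1) + altProd (k + 1) a b + altProd (k + 1) b a)

theorem heckeTail_comm (t : R) (a b : B) : ∀ k, heckeTail t a b k = heckeTail t b a k
  | 0 => rfl
  | 1 => rfl
  | k + 2 => by rw [heckeTail, heckeTail, heckeTail_comm t a b (k + 1), add_right_comm]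

theorem mul_heckeTail {t s : R} (hts : t * s = 1) {a b : B}
    (ha : a * a = (s - t) • a + 1) :
    ∀ k, a * heckeTail t a b (k + 2) =
      t • altProd (k + 2) a b + altProd (k + 1) a b + heckeTail t a b (k + 1)
  | 0 => by
    simp only [heckeTail, altProd, mul_smul_comm, mul_add, mul_one, ha]
    match_scalars <;> first | ring1 | linear_combination hts
  | k + 1 => by
    have h1 : a * altProd (k + 2) a b = (s - t) • altProd (k + 2) a b + altProd (k + 1) b a := by
      rw [altProd_succ, ← mul_assoc, ha, add_mul, smul_mul_assoc, one_mul]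
    rw [heckeTail, mul_smul_comm, mul_add, mul_add, mul_heckeTail hts ha k, h1,
      ← altProd_succ, heckeTail]
    match_scalars <;> first | ring1 | linear_combination hts

/-- For elements `a` and `b` which satisfy the quadratic relation of the Hecke algebra, `klProd` of
`a + t` and `b + t` is a Kazhdan-Lusztig element of the infinite dihedral group: the sum of
`t ^ (k + 1 - ℓ v)` times the alternating product for `v`, over all `v` below `a b a ⋯` in the
Bruhat order. -/
theorem klProd_add_scalar {t s : R} (hts : t * s = 1) :
    ∀ (k : ℕ) {a b : B} (_ : a * a = (s - t) • a + 1) (_ : b * b = (s - t) • b + 1),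
      klProd (-1 : R) (k + 1) (a + t • 1) (b + t • 1) =
        altProd (k + 1) a b + heckeTail t a b (k + 1)
  | 0, a, b, _, _ => by simp [klProd, altProd, heckeTail]
  | 1, a, b, _, _ => by
    simp only [klProd, altProd, heckeTail, smul_zero, add_zero, mul_one, mul_add, add_mul,
      smul_mul_assoc, one_mul, mul_smul_comm]
    module
  | k + 2, a, b, ha, hb => by
    rw [klProd, klProd_add_scalar hts (k + 1) hb ha, klProd_add_scalar hts k ha hb,
      add_mul, mul_add, mul_add, ← altProd_succ, heckeTail_comm t b a, mul_heckeTail hts ha k,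
      show heckeTail t a b (k + 3) =
        t • (heckeTail t a b (k + 2) + altProd (k + 2) a b + altProd (k + 2) b a) from rfl]
    simp only [smul_mul_assoc, one_mul]
    module

end KLProd

/-! ### Braid relations of divided difference elements in rank two -/

section RankTwo

variable {R Q B : Type*} [CommRing R] [CommRing Q] [Algebra R Q] [Ring B] [Algebra R B]

/-- The elements `(-1) ^ k (⋯ d d' d) (1 - d')`, with `k` alternating factors before
`1 - d'`. They correspond to the cosets of the subgroup generated by `d'`. -/
def cosetVec (d d' : B) : ℕ → B
  | 0 => 1 - d'
  | k + 1 => -((if Even k then d else d') * cosetVec d d' k)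

/-- A linear combination of the first six elements `cosetVec d d' k`. -/
def cosetComb (ι : Q →ₐ[R] B) (d d' : B) (f₀ f₁ f₂ f₃ f₄ f₅ : Q) : B :=
  ι f₀ * cosetVec d d' 0 + ι f₁ * cosetVec d d' 1 + ι f₂ * cosetVec d d' 2 +
    ι f₃ * cosetVec d d' 3 + ι f₄ * cosetVec d d' 4 + ι f₅ * cosetVec d d' 5

theorem cosetComb_congr {ι : Q →ₐ[R] B} {d d' : B} {f₀ f₁ f₂ f₃ f₄ f₅ g₀ g₁ g₂ g₃ g₄ g₅ : Q}
    (h₀ : f₀ = g₀) (h₁ : f₁ = g₁) (h₂ : f₂ = g₂) (h₃ : f₃ = g₃) (h₄ : f₄ = g₄) (h₅ : f₅ = g₅) :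
    cosetComb ι d d' f₀ f₁ f₂ f₃ f₄ f₅ = cosetComb ι d d' g₀ g₁ g₂ g₃ g₄ g₅ := by
  rw [h₀, h₁, h₂, h₃, h₄, h₅]

theorem cosetComb_add (ι : Q →ₐ[R] B) (d d' : B) (f₀ f₁ f₂ f₃ f₄ f₅ g₀ g₁ g₂ g₃ g₄ g₅ : Q) :
    cosetComb ι d d' f₀ f₁ f₂ f₃ f₄ f₅ + cosetComb ι d d' g₀ g₁ g₂ g₃ g₄ g₅ =
      cosetComb ι d d' (f₀ + g₀) (f₁ + g₁) (f₂ + g₂) (f₃ + g₃) (f₄ + g₄) (f₅ + g₅) := by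
  simp only [cosetComb, map_add, add_mul]; abel

theorem smul_cosetComb (ι : Q →ₐ[R] B) (d d' : B) (n : R) (f₀ f₁ f₂ f₃ f₄ f₅ : Q) :
    n • cosetComb ι d d' f₀ f₁ f₂ f₃ f₄ f₅ =
      cosetComb ι d d' (n • f₀) (n • f₁) (n • f₂) (n • f₃) (n • f₄) (n • f₅) := by
  simp only [cosetComb, map_smul, smul_mul_assoc, smul_add]

/-- Multiplication by `p (1 - d)` on a coefficient times an element `e`, where `d` exchanges `e`
and `-e'`. -/
theorem demazure_mul {ι : Q →ₐ[R] B} {σ : Q →ₐ[R] Q} {d e e' : B}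
    (hσ : ∀ q, d * ι q = ι (σ q) * d) (he : d * e = -e') (p f : Q) :
    ι p * (1 - d) * (ι f * e) = ι (p * f) * e + ι (p * σ f) * e' := by
  have h : d * (ι f * e) = -(ι (σ f) * e') := by rw [← mul_assoc, hσ, mul_assoc, he, mul_neg]
  rw [mul_assoc, sub_mul, one_mul, h, sub_neg_eq_add, mul_add, map_mul, map_mul, mul_assoc,
    mul_assoc]

variable {ι : Q →ₐ[R] B} {σ τ : Q →ₐ[R] Q} {d d' : B}

theorem demazure_mul_cosetComb (hd : d * d = 1) (hσ : ∀ q, d * ι q = ι (σ q) * d)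
    (p f₀ f₁ f₂ f₃ f₄ f₅ : Q) :
    ι p * (1 - d) * cosetComb ι d d' f₀ f₁ f₂ f₃ f₄ f₅ =
      cosetComb ι d d' (p * (f₀ + σ f₁)) (p * (f₁ + σ f₀)) (p * (f₂ + σ f₃)) (p * (f₃ + σ f₂))
        (p * (f₄ + σ f₅)) (p * (f₅ + σ f₄)) := by
  have h (k : ℕ) (hk : Even k) : d * cosetVec d d' k = -cosetVec d d' (k + 1) := by
    rw [cosetVec, if_pos hk, neg_neg]
  have h' (k : ℕ) (hk : Even k) : d * cosetVec d d' (k + 1) = -cosetVec d d' k := by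
    rw [cosetVec, if_pos hk, mul_neg, ← mul_assoc, hd, one_mul]
  simp only [cosetComb, mul_add (ι p * (1 - d)), demazure_mul hσ (h 0 (by decide)),
    demazure_mul hσ (h 2 (by decide)), demazure_mul hσ (h 4 (by decide)),
    demazure_mul hσ (h' 0 (by decide)), demazure_mul hσ (h' 2 (by decide)),
    demazure_mul hσ (h' 4 (by decide)), mul_add p, map_add, add_mul]
  abel

theorem demazure_mul_cosetComb' (hd' : d' * d' = 1) (hτ : ∀ q, d' * ι q = ι (τ q) * d')
    (p f₀ f₁ f₂ f₃ f₄ : Q) :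
    ι p * (1 - d') * cosetComb ι d d' f₀ f₁ f₂ f₃ f₄ 0 =
      cosetComb ι d d' (p * (f₀ + τ f₀)) (p * (f₁ + τ f₂)) (p * (f₂ + τ f₁)) (p * (f₃ + τ f₄))
        (p * (f₄ + τ f₃)) 0 := by
  have h (k : ℕ) (hk : ¬ Even k) : d' * cosetVec d d' k = -cosetVec d d' (k + 1) := by
    rw [cosetVec, if_neg hk, neg_neg]
  have h' (k : ℕ) (hk : ¬ Even k) : d' * cosetVec d d' (k + 1) = -cosetVec d d' k := by
    rw [cosetVec, if_neg hk, mul_neg, ← mul_assoc, hd', one_mul]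
  have h0 : d' * cosetVec d d' 0 = -cosetVec d d' 0 := by
    rw [cosetVec, mul_sub, hd', mul_one, neg_sub]
  simp only [cosetComb, mul_add (ι p * (1 - d')), demazure_mul hτ h0,
    demazure_mul hτ (h 1 (by decide)), demazure_mul hτ (h 3 (by decide)),
    demazure_mul hτ (h' 1 (by decide)), demazure_mul hτ (h' 3 (by decide)), mul_add p, map_add,
    add_mul, map_zero, zero_mul, add_zero]
  abel

theorem klProd_one_demazure (n : R) (p : Q) (b : B) :
    klProd n 1 (ι p * (1 - d')) b = cosetComb ι d d' p 0 0 0 0 0 := by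
  simp [klProd, cosetComb, cosetVec]

/-! In the following expansions, `p₁, p₂, …` stand for the elements `1 / x_β`, for the positive roots
`β` of a subsystem of rank two in a convex order. All coefficients of `klProd` are equal to the
product of the `p_k`, which does not depend on the order of the two arguments. -/

theorem klProd_two_demazure (hd : d * d = 1) (hσ : ∀ q, d * ι q = ι (σ q) * d) (n : R)
    {p₁ p₂ : Q} (hσ₂ : σ p₂ = p₂) :
    klProd n 2 (ι p₁ * (1 - d)) (ι p₂ * (1 - d')) =
      cosetComb ι d d' (p₁ * p₂) (p₁ * p₂) 0 0 0 0 := by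
  simp only [klProd_add_two, klProd_zero, klProd_one_demazure (d := d),
    demazure_mul_cosetComb hd hσ, map_zero, add_zero, zero_add, mul_zero, hσ₂, smul_zero]

theorem klProd_three_demazure (hd : d * d = 1) (hd' : d' * d' = 1)
    (hσ : ∀ q, d * ι q = ι (σ q) * d) (hτ : ∀ q, d' * ι q = ι (τ q) * d') {m n : R}
    {p₁ p₂ p₃ : Q} (hτ₃ : τ p₃ = algebraMap R Q m - p₃)
    (hσ₃ : σ p₃ = p₂) (hτ₁ : τ p₁ = p₂) (hτ₂ : τ p₂ = p₁)
    (h : p₁ * p₃ + algebraMap R Q n = p₂ * (p₁ + p₃ - algebraMap R Q m)) :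
    klProd n 3 (ι p₃ * (1 - d')) (ι p₁ * (1 - d)) =
      cosetComb ι d d' (p₁ * p₂ * p₃) (p₁ * p₂ * p₃) (p₁ * p₂ * p₃) 0 0 0 := by
  simp only [klProd_add_two, klProd_zero, klProd_one_demazure (d := d),
    demazure_mul_cosetComb hd hσ, demazure_mul_cosetComb' hd' hτ, smul_cosetComb, cosetComb_add,
    map_zero, add_zero, mul_zero, zero_add, smul_zero]
  simp only [map_mul, hσ₃, hτ₁, hτ₂, hτ₃,
    Algebra.smul_def]
  clear hσ hτ hd hd' hσ₃ hτ₁ hτ₂ hτ₃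
  apply cosetComb_congr <;> grind

/-- The two alternatives in the hypothesis are exchanged by reversing the order of the roots. -/
theorem klProd_four_demazure (hd : d * d = 1) (hd' : d' * d' = 1)
    (hσ : ∀ q, d * ι q = ι (σ q) * d) (hτ : ∀ q, d' * ι q = ι (τ q) * d') {m n : R}
    {p₁ p₂ p₃ p₄ : Q} (hσ₁ : σ p₁ = algebraMap R Q m - p₁) (hτ₄ : τ p₄ = algebraMap R Q m - p₄)
    (hσ₂ : σ p₂ = p₄) (hσ₃ : σ p₃ = p₃) (hσ₄ : σ p₄ = p₂)
    (hτ₁ : τ p₁ = p₃) (hτ₂ : τ p₂ = p₂)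
    (h : (p₁ * p₃ + algebraMap R Q n = p₂ * (p₁ + p₃ - algebraMap R Q m) ∧
        p₁ * p₄ + algebraMap R Q n = p₃ * (p₁ + p₄ - algebraMap R Q m)) ∨
      (p₄ * p₂ + algebraMap R Q n = p₃ * (p₄ + p₂ - algebraMap R Q m) ∧
        p₄ * p₁ + algebraMap R Q n = p₂ * (p₄ + p₁ - algebraMap R Q m))) :
    klProd n 4 (ι p₁ * (1 - d)) (ι p₄ * (1 - d')) =
      cosetComb ι d d' (p₁ * p₂ * p₃ * p₄) (p₁ * p₂ * p₃ * p₄) (p₁ * p₂ * p₃ * p₄)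
        (p₁ * p₂ * p₃ * p₄) 0 0 := by
  simp only [klProd_add_two, klProd_zero, klProd_one_demazure (d := d),
    demazure_mul_cosetComb hd hσ, demazure_mul_cosetComb' hd' hτ, smul_cosetComb, cosetComb_add,
    map_zero, add_zero, mul_zero, zero_add, smul_zero]
  simp only [map_mul, map_add, map_sub,
    AlgHom.commutes, hσ₁, hσ₂, hσ₃, hσ₄, hτ₁, hτ₂, hτ₄, Algebra.smul_def]
  clear hσ hτ hd hd' hσ₁ hσ₂ hσ₃ hσ₄ hτ₁ hτ₂ hτ₄
  rcases h with ⟨h, h'⟩ | ⟨h, h'⟩ <;> apply cosetComb_congr <;> grind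

/-- The two alternatives in the hypothesis are exchanged by reversing the order of the roots. -/
theorem klProd_six_demazure (hd : d * d = 1) (hd' : d' * d' = 1)
    (hσ : ∀ q, d * ι q = ι (σ q) * d) (hτ : ∀ q, d' * ι q = ι (τ q) * d') {m n : R}
    {p₁ p₂ p₃ p₄ p₅ p₆ : Q}
    (hσ₁ : σ p₁ = algebraMap R Q m - p₁) (hτ₆ : τ p₆ = algebraMap R Q m - p₆)
    (hσ₂ : σ p₂ = p₆) (hσ₃ : σ p₃ = p₅) (hσ₄ : σ p₄ = p₄) (hσ₅ : σ p₅ = p₃) (hσ₆ : σ p₆ = p₂)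
    (hτ₁ : τ p₁ = p₅) (hτ₂ : τ p₂ = p₄) (hτ₃ : τ p₃ = p₃) (hτ₄ : τ p₄ = p₂) (hτ₅ : τ p₅ = p₁)
    (h : (p₁ * p₅ + algebraMap R Q n = p₃ * (p₁ + p₅ - algebraMap R Q m) ∧
        p₂ * p₆ + algebraMap R Q n = p₄ * (p₂ + p₆ - algebraMap R Q m) ∧
        p₁ * p₃ + algebraMap R Q n = p₂ * (p₁ + p₃ - algebraMap R Q m) ∧
        p₃ * p₅ + algebraMap R Q n = p₄ * (p₃ + p₅ - algebraMap R Q m) ∧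
        p₁ * p₆ + algebraMap R Q n = p₅ * (p₁ + p₆ - algebraMap R Q m)) ∨
      (p₆ * p₂ + algebraMap R Q n = p₄ * (p₆ + p₂ - algebraMap R Q m) ∧
        p₅ * p₁ + algebraMap R Q n = p₃ * (p₅ + p₁ - algebraMap R Q m) ∧
        p₆ * p₄ + algebraMap R Q n = p₅ * (p₆ + p₄ - algebraMap R Q m) ∧
        p₄ * p₂ + algebraMap R Q n = p₃ * (p₄ + p₂ - algebraMap R Q m) ∧
        p₆ * p₁ + algebraMap R Q n = p₂ * (p₆ + p₁ - algebraMap R Q m))) :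
    klProd n 6 (ι p₁ * (1 - d)) (ι p₆ * (1 - d')) =
      cosetComb ι d d' (p₁ * p₂ * p₃ * p₄ * p₅ * p₆) (p₁ * p₂ * p₃ * p₄ * p₅ * p₆)
        (p₁ * p₂ * p₃ * p₄ * p₅ * p₆) (p₁ * p₂ * p₃ * p₄ * p₅ * p₆)
        (p₁ * p₂ * p₃ * p₄ * p₅ * p₆) (p₁ * p₂ * p₃ * p₄ * p₅ * p₆) := by
  simp only [klProd_add_two, klProd_zero, klProd_one_demazure (d := d),
    demazure_mul_cosetComb hd hσ, demazure_mul_cosetComb' hd' hτ, smul_cosetComb, cosetComb_add,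
    map_zero, add_zero, mul_zero, zero_add, smul_zero]
  simp only [map_mul, map_add, map_sub,
    AlgHom.commutes, hσ₁, hσ₂, hσ₃, hσ₄, hσ₅, hσ₆, hτ₁, hτ₂, hτ₃, hτ₄, hτ₅, hτ₆,
    Algebra.smul_def]
  clear hσ hτ hd hd' hσ₁ hσ₂ hσ₃ hσ₄ hσ₅ hσ₆ hτ₁ hτ₂ hτ₃ hτ₄ hτ₅ hτ₆
  rcases h with ⟨h, h', h₃, h₄, h₅⟩ | ⟨h, h', h₃, h₄, h₅⟩ <;> apply cosetComb_congr <;>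
    grind (ringSteps := 200000)

end RankTwo

section RankTwo

variable {R Q B : Type*} [CommRing R] [CommRing Q] [Algebra R Q] [Ring B] [Algebra R B]
variable {ι : Q →ₐ[R] B} {σ τ : Q →ₐ[R] Q} {d d' : B}

theorem klProd_demazure_comm_two (hd : d * d = 1) (hd' : d' * d' = 1)
    (hσ : ∀ q, d * ι q = ι (σ q) * d) (hτ : ∀ q, d' * ι q = ι (τ q) * d')
    (hb : altProd 2 d d' = altProd 2 d' d) (n : R)
    {p₁ p₂ : Q} (hσ₂ : σ p₂ = p₂) (hτ₁ : τ p₁ = p₁) :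
    klProd n 2 (ι p₁ * (1 - d)) (ι p₂ * (1 - d')) =
      klProd n 2 (ι p₂ * (1 - d')) (ι p₁ * (1 - d)) := by
  rw [klProd_two_demazure hd hσ n hσ₂, klProd_two_demazure hd' hτ n hτ₁, mul_comm p₂ p₁]
  simp only [altProd, mul_one] at hb
  simp [cosetComb, cosetVec, mul_sub, hb]
  abel

theorem klProd_demazure_comm_three (hd : d * d = 1) (hd' : d' * d' = 1)
    (hσ : ∀ q, d * ι q = ι (σ q) * d) (hτ : ∀ q, d' * ι q = ι (τ q) * d')
    (hb : altProd 3 d d' = altProd 3 d' d) {m n : R}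
    {p₁ p₂ p₃ : Q} (hσ₁ : σ p₁ = algebraMap R Q m - p₁) (hτ₃ : τ p₃ = algebraMap R Q m - p₃)
    (hσ₂ : σ p₂ = p₃) (hσ₃ : σ p₃ = p₂) (hτ₁ : τ p₁ = p₂) (hτ₂ : τ p₂ = p₁)
    (h : p₁ * p₃ + algebraMap R Q n = p₂ * (p₁ + p₃ - algebraMap R Q m)) :
    klProd n 3 (ι p₁ * (1 - d)) (ι p₃ * (1 - d')) =
      klProd n 3 (ι p₃ * (1 - d')) (ι p₁ * (1 - d)) := by
  rw [klProd_three_demazure hd hd' hσ hτ hτ₃ hσ₃ hτ₁ hτ₂ h,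
    klProd_three_demazure hd' hd hτ hσ hσ₁ hτ₁ hσ₃ hσ₂
      (by rw [mul_comm p₃, add_comm p₃, h]),
    show p₃ * p₂ * p₁ = p₁ * p₂ * p₃ by ring]
  simp only [altProd, mul_one] at hb
  simp [cosetComb, cosetVec, mul_sub, hb]
  abel

theorem klProd_demazure_comm_four (hd : d * d = 1) (hd' : d' * d' = 1)
    (hσ : ∀ q, d * ι q = ι (σ q) * d) (hτ : ∀ q, d' * ι q = ι (τ q) * d')
    (hb : altProd 4 d d' = altProd 4 d' d) {m n : R}
    {p₁ p₂ p₃ p₄ : Q} (hσ₁ : σ p₁ = algebraMap R Q m - p₁) (hτ₄ : τ p₄ = algebraMap R Q m - p₄)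
    (hσ₂ : σ p₂ = p₄) (hσ₃ : σ p₃ = p₃) (hσ₄ : σ p₄ = p₂)
    (hτ₁ : τ p₁ = p₃) (hτ₂ : τ p₂ = p₂) (hτ₃ : τ p₃ = p₁)
    (h : p₁ * p₃ + algebraMap R Q n = p₂ * (p₁ + p₃ - algebraMap R Q m))
    (h' : p₁ * p₄ + algebraMap R Q n = p₃ * (p₁ + p₄ - algebraMap R Q m)) :
    klProd n 4 (ι p₁ * (1 - d)) (ι p₄ * (1 - d')) =
      klProd n 4 (ι p₄ * (1 - d')) (ι p₁ * (1 - d)) := by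
  rw [klProd_four_demazure hd hd' hσ hτ hσ₁ hτ₄ hσ₂ hσ₃ hσ₄ hτ₁ hτ₂ (.inl ⟨h, h'⟩),
    klProd_four_demazure hd' hd hτ hσ hτ₄ hσ₁ hτ₃ hτ₂ hτ₁ hσ₄ hσ₃ (.inr ⟨h, h'⟩),
    show p₄ * p₃ * p₂ * p₁ = p₁ * p₂ * p₃ * p₄ by ring]
  simp only [altProd, mul_one] at hb
  simp [cosetComb, cosetVec, mul_sub, hb]
  abel

theorem klProd_demazure_comm_six (hd : d * d = 1) (hd' : d' * d' = 1)
    (hσ : ∀ q, d * ι q = ι (σ q) * d) (hτ : ∀ q, d' * ι q = ι (τ q) * d')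
    (hb : altProd 6 d d' = altProd 6 d' d) {m n : R}
    {p₁ p₂ p₃ p₄ p₅ p₆ : Q}
    (hσ₁ : σ p₁ = algebraMap R Q m - p₁) (hτ₆ : τ p₆ = algebraMap R Q m - p₆)
    (hσ₂ : σ p₂ = p₆) (hσ₃ : σ p₃ = p₅) (hσ₄ : σ p₄ = p₄) (hσ₅ : σ p₅ = p₃) (hσ₆ : σ p₆ = p₂)
    (hτ₁ : τ p₁ = p₅) (hτ₂ : τ p₂ = p₄) (hτ₃ : τ p₃ = p₃) (hτ₄ : τ p₄ = p₂) (hτ₅ : τ p₅ = p₁)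
    (h₁₅ : p₁ * p₅ + algebraMap R Q n = p₃ * (p₁ + p₅ - algebraMap R Q m))
    (h₂₆ : p₂ * p₆ + algebraMap R Q n = p₄ * (p₂ + p₆ - algebraMap R Q m))
    (h₁₃ : p₁ * p₃ + algebraMap R Q n = p₂ * (p₁ + p₃ - algebraMap R Q m))
    (h₃₅ : p₃ * p₅ + algebraMap R Q n = p₄ * (p₃ + p₅ - algebraMap R Q m))
    (h₁₆ : p₁ * p₆ + algebraMap R Q n = p₅ * (p₁ + p₆ - algebraMap R Q m)) :
    klProd n 6 (ι p₁ * (1 - d)) (ι p₆ * (1 - d')) =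
      klProd n 6 (ι p₆ * (1 - d')) (ι p₁ * (1 - d)) := by
  rw [klProd_six_demazure hd hd' hσ hτ hσ₁ hτ₆ hσ₂ hσ₃ hσ₄ hσ₅ hσ₆ hτ₁ hτ₂ hτ₃ hτ₄ hτ₅
      (.inl ⟨h₁₅, h₂₆, h₁₃, h₃₅, h₁₆⟩),
    klProd_six_demazure hd' hd hτ hσ hτ₆ hσ₁ hτ₅ hτ₄ hτ₃ hτ₂ hτ₁ hσ₆ hσ₅ hσ₄ hσ₃ hσ₂
      (.inr ⟨h₁₅, h₂₆, h₁₃, h₃₅, h₁₆⟩),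
    show p₆ * p₅ * p₄ * p₃ * p₂ * p₁ = p₁ * p₂ * p₃ * p₄ * p₅ * p₆ by ring]
  simp only [altProd, mul_one] at hb
  simp [cosetComb, cosetVec, mul_sub, hb, show ¬ Even 3 by decide, show Even 4 by decide]
  abel

end RankTwo

/-! ### The length function on the Weyl group -/

section AltProd

theorem altProd_add {B : Type*} [Monoid B] (m n : ℕ) (a b : B) :
    altProd (m + n) a b = altProd m a b * (if Even m then altProd n a b else altProd n b a) := by
  induction m generalizing a b with
  | zero => simp [altProd]
  | succ m ih =>
    rw [Nat.succ_add, altProd_succ, ih, altProd_succ, mul_assoc]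
    by_cases hm : Even m <;> simp [hm, Nat.even_add_one]

theorem altProd_eq_pow_mul {B : Type*} [Group B] {a b : B} (ha : a * a = 1) (hb : b * b = 1)
    (n : ℕ) : altProd n a b = (a * b) ^ n * altProd n b a := by
  have hinv : b * a = (a * b)⁻¹ := by
    rw [mul_inv_rev, inv_eq_of_mul_eq_one_left ha, inv_eq_of_mul_eq_one_left hb]
  induction n with
  | zero => simp [altProd]
  | succ n ih =>
    have hc : a * (a * b) ^ n = (b * a) ^ n * a := by
      have : SemiconjBy a (a * b) (b * a) := by
        rw [SemiconjBy, ← mul_assoc, ha, mul_assoc, ha, one_mul, mul_one]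
      exact this.pow_right n
    rw [altProd_succ, altProd_succ, pow_succ, mul_assoc, mul_assoc, ← mul_assoc b b, hb, one_mul,
      ih, ← mul_assoc a, hc, hinv, inv_pow, ← mul_assoc, ← mul_assoc, mul_inv_cancel, one_mul]

theorem altProd_orderOf_comm {B : Type*} [Group B] {a b : B} (ha : a * a = 1) (hb : b * b = 1) :
    altProd (orderOf (a * b)) a b = altProd (orderOf (a * b)) b a := by
  rw [altProd_eq_pow_mul ha hb, pow_orderOf_eq_one, one_mul]

end AltProd

namespace KacMoodyRealization

variable {k h : Type*} [Field k] [AddCommGroup h] [Module k h]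
  {l : ℕ} {A : Matrix (Fin l) (Fin l) ℤ} (D : KacMoodyRealization k h A)

theorem simpleRefl_mul_self (i : Fin l) : D.simpleRefl i * D.simpleRefl i = 1 := by
  refine Subtype.ext (LinearEquiv.ext fun ψ => ?_)
  exact Module.involutive_reflection (D.root_coroot_self i) ψ

theorem simpleRefl_inv (i : Fin l) : (D.simpleRefl i)⁻¹ = D.simpleRefl i :=
  inv_eq_of_mul_eq_one_left (D.simpleRefl_mul_self i)

theorem simpleRefl_mul_cancel (i : Fin l) (w : D.weylGroup) :
    D.simpleRefl i * (D.simpleRefl i * w) = w := by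
  rw [← mul_assoc, simpleRefl_mul_self, one_mul]

/-- The product in the Weyl group of the simple reflections in a word. -/
def wordProd (ω : List (Fin l)) : D.weylGroup := (ω.map D.simpleRefl).prod

@[simp] theorem wordProd_nil : D.wordProd [] = 1 := rfl

@[simp] theorem wordProd_cons (i : Fin l) (ω : List (Fin l)) :
    D.wordProd (i :: ω) = D.simpleRefl i * D.wordProd ω := rfl

theorem wordProd_append (ω ν : List (Fin l)) :
    D.wordProd (ω ++ ν) = D.wordProd ω * D.wordProd ν := by simp [wordProd]

theorem wordProd_surjective : Function.Surjective D.wordProd := by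
  rintro ⟨w, hw⟩
  suffices ∃ ω, ((D.wordProd ω : D.weylGroup) : Module.Dual k h ≃ₗ[k] Module.Dual k h) = w by
    obtain ⟨ω, h⟩ := this
    exact ⟨ω, Subtype.ext h⟩
  induction hw using Subgroup.closure_induction'' with
  | mem x hx => obtain ⟨i, rfl⟩ := hx; exact ⟨[i], by simp [simpleRefl]⟩
  | inv_mem x hx =>
    obtain ⟨i, rfl⟩ := hx
    refine ⟨[i], ?_⟩
    have := congrArg Subtype.val (D.simpleRefl_inv i)
    simpa [simpleRefl] using this.symm
  | one => exact ⟨[], rfl⟩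
  | mul x y _ _ hx hy =>
    obtain ⟨ω, rfl⟩ := hx
    obtain ⟨ν, rfl⟩ := hy
    exact ⟨ω ++ ν, by rw [wordProd_append]; rfl⟩

/-- The length of an element of the Weyl group with respect to the simple reflections. -/
def length (w : D.weylGroup) : ℕ := sInf (List.length '' (D.wordProd ⁻¹' {w}))

theorem exists_reduced_word (w : D.weylGroup) :
    ∃ ω, D.wordProd ω = w ∧ ω.length = D.length w := by
  have : (List.length '' (D.wordProd ⁻¹' {w})).Nonempty :=
    Set.Nonempty.image _ (D.wordProd_surjective w)
  obtain ⟨ω, h, h'⟩ := Nat.sInf_mem this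
  exact ⟨ω, h, h'⟩

theorem length_wordProd_le (ω : List (Fin l)) : D.length (D.wordProd ω) ≤ ω.length :=
  Nat.sInf_le ⟨ω, rfl, rfl⟩

theorem length_simpleRefl_mul_le (i : Fin l) (w : D.weylGroup) :
    D.length (D.simpleRefl i * w) ≤ D.length w + 1 := by
  obtain ⟨ω, rfl, h⟩ := D.exists_reduced_word w
  rw [← h]
  exact D.length_wordProd_le (i :: ω)

theorem length_le_simpleRefl_mul (i : Fin l) (w : D.weylGroup) :
    D.length w ≤ D.length (D.simpleRefl i * w) + 1 := by
  have := D.length_simpleRefl_mul_le i (D.simpleRefl i * w)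
  rwa [simpleRefl_mul_cancel] at this

theorem length_altProd_mul_le (i j : Fin l) (n : ℕ) (w : D.weylGroup) :
    D.length (altProd n (D.simpleRefl i) (D.simpleRefl j) * w) ≤ n + D.length w := by
  induction n generalizing i j with
  | zero => simp [altProd]
  | succ n ih =>
    rw [altProd_succ, mul_assoc]
    have := D.length_simpleRefl_mul_le i (altProd n (D.simpleRefl j) (D.simpleRefl i) * w)
    have := ih j i
    omega

theorem det_simpleReflection (i : Fin l) : LinearEquiv.det (D.simpleReflection i) = -1 := by
  have := D.finite
  ext
  rw [LinearEquiv.coe_det]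
  have h : ((D.simpleReflection i : Module.Dual k h ≃ₗ[k] Module.Dual k h) :
      Module.Dual k h →ₗ[k] Module.Dual k h) =
      LinearMap.transvection (-Module.Dual.eval k h (D.coroot i)) (D.root i) := by
    ext φ : 1
    simp only [LinearEquiv.coe_coe, D.simpleReflection_apply, LinearMap.transvection.apply]
    simp [sub_eq_add_neg]
  rw [h, LinearMap.transvection.det, LinearMap.neg_apply, D.root_coroot_self]
  norm_num

theorem det_wordProd (ω : List (Fin l)) :
    LinearEquiv.det (D.wordProd ω).1 = (-1) ^ ω.length := by
  induction ω with
  | nil => simp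
  | cons i ω ih =>
    rw [wordProd_cons, Subgroup.coe_mul, map_mul, ih, List.length_cons, pow_succ']
    exact congrArg (· * _) (D.det_simpleReflection i)

theorem exists_simpleRefl_mul_lt {w : D.weylGroup} (hw : D.length w ≠ 0) :
    ∃ j, D.length (D.simpleRefl j * w) < D.length w := by
  obtain ⟨ω, rfl, h⟩ := D.exists_reduced_word w
  cases ω with
  | nil => exact absurd h.symm hw
  | cons j ω =>
    refine ⟨j, ?_⟩
    rw [wordProd_cons, simpleRefl_mul_cancel]
    have := D.length_wordProd_le ω
    rw [wordProd_cons, List.length_cons] at h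
    omega

theorem eq_one_of_length_eq_zero {w : D.weylGroup} (hw : D.length w = 0) : w = 1 := by
  obtain ⟨ω, rfl, h⟩ := D.exists_reduced_word w
  rw [hw, List.length_eq_zero_iff] at h
  rw [h, wordProd_nil]

variable [CharZero k]

/-- The length of an element is determined modulo two by its determinant. -/
theorem length_simpleRefl_mul_ne (i : Fin l) (w : D.weylGroup) :
    D.length (D.simpleRefl i * w) ≠ D.length w := by
  intro h
  obtain ⟨ω, hω, h'⟩ := D.exists_reduced_word w
  obtain ⟨ν, hν, h''⟩ := D.exists_reduced_word (D.simpleRefl i * w)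
  have h1 := D.det_wordProd (i :: ω)
  rw [wordProd_cons, hω, ← hν, det_wordProd, h'', h, ← h', List.length_cons, pow_succ'] at h1
  have h2 := congrArg Units.val h1
  push_cast at h2
  rcases neg_one_pow_eq_or k ω.length with h | h <;> rw [h] at h2 <;> norm_num at h2

theorem length_simpleRefl_mul_cases (i : Fin l) (w : D.weylGroup) :
    D.length (D.simpleRefl i * w) = D.length w + 1 ∨
      D.length (D.simpleRefl i * w) + 1 = D.length w := by
  have := D.length_simpleRefl_mul_ne i w
  have := D.length_simpleRefl_mul_le i w
  have := D.length_le_simpleRefl_mul i w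
  omega

/-- An element `w` with left descent `j` is the product of an alternating word in `s_j, s_i`
starting with `s_j`, and an element `v` with neither `i` nor `j` as left descent, and the lengths
add up. -/
theorem exists_eq_altProd_mul {i j : Fin l} {w : D.weylGroup}
    (hj : D.length (D.simpleRefl j * w) < D.length w) :
    ∃ (n : ℕ) (v : D.weylGroup), 0 < n ∧
      w = altProd n (D.simpleRefl j) (D.simpleRefl i) * v ∧ D.length w = n + D.length v ∧
      D.length v < D.length (D.simpleRefl i * v) ∧ D.length v < D.length (D.simpleRefl j * v) := by
  classical
  let P : ℕ → Prop := fun n => ∃ v : D.weylGroup,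
    w = altProd n (D.simpleRefl j) (D.simpleRefl i) * v ∧ D.length w = n + D.length v
  have hP1 : P 1 := by
    refine ⟨D.simpleRefl j * w, by simp [altProd, simpleRefl_mul_cancel], ?_⟩
    have := D.length_simpleRefl_mul_cases j w
    omega
  have hw1 : 1 ≤ D.length w := by omega
  obtain ⟨v, hv, hl⟩ := Nat.findGreatest_spec hw1 hP1
  have hn : 1 ≤ Nat.findGreatest P (D.length w) := Nat.le_findGreatest hw1 hP1
  have hmax : ¬ P (Nat.findGreatest P (D.length w) + 1) := by
    intro h
    have h' : Nat.findGreatest P (D.length w) + 1 ≤ D.length w := by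
      obtain ⟨v', _, hl'⟩ := h
      omega
    have := Nat.le_findGreatest h' h
    omega
  generalize Nat.findGreatest P (D.length w) = n at hv hl hn hmax
  obtain ⟨n, rfl⟩ : ∃ n', n = n' + 1 := ⟨n - 1, by omega⟩
  -- The letter that would prolong the alternating word is not a descent of `v` by maximality.
  have key1 : ∀ x, altProd (n + 2) (D.simpleRefl j) (D.simpleRefl i) =
      altProd (n + 1) (D.simpleRefl j) (D.simpleRefl i) * D.simpleRefl x →
      D.length v < D.length (D.simpleRefl x * v) := by
    intro x hx
    rcases D.length_simpleRefl_mul_cases x v with h | h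
    · omega
    · refine absurd ⟨D.simpleRefl x * v, ?_, by omega⟩ hmax
      rw [hx, mul_assoc, simpleRefl_mul_cancel, hv]
  -- The last letter of the alternating word is not a descent of `v` as the lengths add up.
  have key2 : ∀ x, altProd (n + 1) (D.simpleRefl j) (D.simpleRefl i) =
      altProd n (D.simpleRefl j) (D.simpleRefl i) * D.simpleRefl x →
      D.length v < D.length (D.simpleRefl x * v) := by
    intro x hx
    rcases D.length_simpleRefl_mul_cases x v with h | h
    · omega
    · have h1 := D.length_altProd_mul_le j i n (D.simpleRefl x * v)
      rw [← mul_assoc, ← hx, ← hv] at h1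
      omega
  refine ⟨n + 1, v, by omega, hv, hl, ?_⟩
  have e1 := altProd_add (n + 1) 1 (D.simpleRefl j) (D.simpleRefl i)
  have e2 := altProd_add n 1 (D.simpleRefl j) (D.simpleRefl i)
  by_cases hev : Even n
  · have hev' : ¬ Even (n + 1) := by rwa [Nat.even_add_one, not_not]
    simp only [hev, hev', if_true, if_false, altProd, mul_one] at e1 e2
    exact ⟨key1 i e1, key2 j e2⟩
  · have hev' : Even (n + 1) := by rwa [Nat.even_add_one]
    simp only [hev, hev', if_true, if_false, altProd, mul_one] at e1 e2
    exact ⟨key2 i e2, key1 j e1⟩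

end KacMoodyRealization

namespace KacMoodyRealization

variable {k h : Type*} [Field k] [AddCommGroup h] [Module k h]
  {l : ℕ} {A : Matrix (Fin l) (Fin l) ℤ} (D : KacMoodyRealization k h A)

/-! ### Rank two subsystems -/

theorem simpleRefl_apply (i : Fin l) (φ : Module.Dual k h) :
    (D.simpleRefl i).1 φ = φ - φ (D.coroot i) • D.root i := D.simpleReflection_apply i φ

theorem simpleRefl_root_self (i : Fin l) : (D.simpleRefl i).1 (D.root i) = -D.root i := by
  rw [simpleRefl_apply, D.pairing, D.gcm.diag]
  push_cast
  module

theorem simpleRefl_root (i j : Fin l) :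
    (D.simpleRefl i).1 (D.root j) = D.root j - (A i j : k) • D.root i := by
  rw [simpleRefl_apply, D.pairing]

/-- `AltNonneg a b n x y` says that the alternating word `⋯ s_i s_j`, with `n` factors, maps
`x α_i + y α_j` to a combination of `α_i` and `α_j` with nonnegative coefficients, when
`a = -a_{ij}` and `b = -a_{ji}`. -/
def AltNonneg : ℤ → ℤ → ℕ → ℤ → ℤ → Prop
  | _, _, 0, x, y => 0 ≤ x ∧ 0 ≤ y
  | a, b, n + 1, x, y => AltNonneg b a n (b * x - y) x

instance decidableAltNonneg (a b : ℤ) : ∀ n x y, Decidable (AltNonneg a b n x y) := fun n => by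
  induction n generalizing a b with
  | zero => exact fun x y => inferInstanceAs (Decidable (0 ≤ x ∧ 0 ≤ y))
  | succ n ih => exact fun x y => ih b a _ _

theorem exists_altProd_inv_apply {n : ℕ} {i j : Fin l} {x y : ℤ}
    (hxy : AltNonneg (-A i j) (-A j i) n x y) :
    ∃ p q : ℕ, (altProd n (D.simpleRefl j) (D.simpleRefl i))⁻¹.1
      (x • D.root i + y • D.root j) = p • D.root i + q • D.root j := by
  induction n generalizing i j x y with
  | zero =>
    obtain ⟨hx, hy⟩ := hxy
    lift x to ℕ using hx
    lift y to ℕ using hy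
    exact ⟨x, y, by simp [altProd]⟩
  | succ n ih =>
    obtain ⟨p, q, hpq⟩ := ih hxy
    refine ⟨q, p, ?_⟩
    rw [altProd_succ, mul_inv_rev, simpleRefl_inv, add_comm (q • _), ← hpq, Subgroup.coe_mul,
      LinearEquiv.mul_apply]
    congr 1
    rw [map_add, map_zsmul, map_zsmul, simpleRefl_root_self, simpleRefl_root]
    module

theorem altNonneg_of_four_le {a b : ℤ} (hab : 4 ≤ a * b) (ha : 0 ≤ a) (hb : 0 ≤ b) (n : ℕ)
    {x y : ℤ} (hx : 0 ≤ x) (hy : 0 ≤ y) (hxy : 2 * y ≤ b * x) : AltNonneg a b n x y := by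
  -- the inequality `2 y ≤ b x` is preserved in each step
  induction n generalizing a b x y with
  | zero => exact ⟨hx, hy⟩
  | succ n ih => exact ih (by rwa [mul_comm]) hb ha (by linarith) hx (by nlinarith)

theorem simpleRefl_add (i j : Fin l) (φ : Module.Dual k h) (x y : k) :
    (D.simpleRefl i).1 (φ + x • D.root i + y • D.root j) =
      φ + (-φ (D.coroot i) - x - A i j * y) • D.root i + y • D.root j := by
  simp only [map_add, map_smul, simpleRefl_root_self, simpleRefl_root]
  rw [simpleRefl_apply]
  module

theorem simpleRefl_add' (i j : Fin l) (φ : Module.Dual k h) (x y : k) :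
    (D.simpleRefl j).1 (φ + x • D.root i + y • D.root j) =
      φ + x • D.root i + (-φ (D.coroot j) - y - A j i * x) • D.root j := by
  rw [add_right_comm, simpleRefl_add, add_right_comm]

/-- The pairs `(a_{ij}, a_{ji})` of off-diagonal entries of the Cartan matrices of finite type and
rank two, with the order of the product of the two simple reflections. -/
inductive FiniteType : ℤ → ℤ → ℕ → Prop
  | a1a1 : FiniteType 0 0 2
  | a2 : FiniteType (-1) (-1) 3
  | b2 : FiniteType (-1) (-2) 4
  | c2 : FiniteType (-2) (-1) 4
  | g2 : FiniteType (-1) (-3) 6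
  | g2' : FiniteType (-3) (-1) 6

theorem finiteType_or_four_le (hA : IsGeneralizedCartanMatrix A) {i j : Fin l} (hij : i ≠ j) :
    (∃ m, FiniteType (A i j) (A j i) m) ∨ 4 ≤ -A i j * -A j i := by
  have h1 := hA.off_diag i j hij
  have h2 := hA.off_diag j i hij.symm
  have h3 := hA.zero_symm i j
  have h4 := hA.zero_symm j i
  generalize A i j = a at *
  generalize A j i = b at *
  by_contra! hc
  obtain ⟨hc, hab⟩ := hc
  rcases eq_or_ne a 0 with rfl | ha
  · rw [h3 rfl] at hc; exact hc 2 .a1a1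
  have hb : b ≠ 0 := fun hb => ha (h4 hb)
  have ha' : a ≤ -1 := by omega
  have hb' : b ≤ -1 := by omega
  have ha3 : -3 ≤ a := by nlinarith
  have hb3 : -3 ≤ b := by nlinarith
  interval_cases a <;> interval_cases b <;> first
    | omega
    | exact hc _ .a2
    | exact hc _ .b2
    | exact hc _ .c2
    | exact hc _ .g2
    | exact hc _ .g2'

theorem FiniteType.pos {a b : ℤ} {m : ℕ} (hm : FiniteType a b m) : 0 < m := by
  cases hm <;> norm_num

theorem FiniteType.pow_eq_one {i j : Fin l} {m : ℕ} (hm : FiniteType (A i j) (A j i) m) :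
    (D.simpleRefl i * D.simpleRefl j) ^ m = 1 := by
  have key (φ : Module.Dual k h) :
      ((D.simpleRefl i * D.simpleRefl j) ^ m).1 (φ + (0 : k) • D.root i + (0 : k) • D.root j) =
        φ + (0 : k) • D.root i + (0 : k) • D.root j := by
    generalize ha : A i j = a at hm
    generalize hb : A j i = b at hm
    cases hm <;>
    simp only [pow_succ, pow_zero, one_mul, Subgroup.coe_mul, LinearEquiv.mul_apply,
        simpleRefl_add, simpleRefl_add', ha, hb] <;>
    · push_cast
      module
  refine Subtype.ext (LinearEquiv.ext fun φ => ?_)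
  simpa using key φ

theorem root_pair_coeff {i j : Fin l} (hij : i ≠ j) {x y : k}
    (hxy : x • D.root i + y • D.root j = D.root i) : x = 1 ∧ y = 0 := by
  have hind : LinearIndependent k ![D.root i, D.root j] := by
    have h1 : Function.Injective ![i, j] := by
      intro p q
      fin_cases p <;> fin_cases q <;> simp [hij, hij.symm]
    have h2 : D.root ∘ ![i, j] = ![D.root i, D.root j] := by
      ext p : 1
      fin_cases p <;> rfl
    exact h2 ▸ D.root_indep.comp _ h1
  obtain ⟨h1, h2⟩ := LinearIndependent.pair_iff.1 hind (x - 1) y (by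
    rw [sub_smul, one_smul, sub_add_eq_add_sub, hxy, sub_self])
  exact ⟨sub_eq_zero.1 h1, h2⟩

theorem root_ne_zero (i : Fin l) : D.root i ≠ 0 := D.root_indep.ne_zero i

theorem altProd_comm_simpleRefl (i j : Fin l) :
    altProd (orderOf (D.simpleRefl i * D.simpleRefl j)) (D.simpleRefl i) (D.simpleRefl j) =
      altProd (orderOf (D.simpleRefl i * D.simpleRefl j)) (D.simpleRefl j) (D.simpleRefl i) :=
  altProd_orderOf_comm (D.simpleRefl_mul_self i) (D.simpleRefl_mul_self j)

/-- The nonnegative integral combinations of simple roots. -/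
def posCone : AddSubmonoid (Module.Dual k h) := AddSubmonoid.closure (Set.range D.root)

theorem root_mem_posCone (i : Fin l) : D.root i ∈ D.posCone :=
  AddSubmonoid.subset_closure ⟨i, rfl⟩

variable [CharZero k]

theorem FiniteType.orderOf_eq {i j : Fin l} (hij : i ≠ j) {m : ℕ}
    (hm : FiniteType (A i j) (A j i) m) : orderOf (D.simpleRefl i * D.simpleRefl j) = m := by
  refine (orderOf_eq_iff hm.pos).2 ⟨hm.pow_eq_one D, fun n hn hn0 h1 => ?_⟩
  have key : ((D.simpleRefl i * D.simpleRefl j) ^ n).1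
      (0 + (1 : k) • D.root i + (0 : k) • D.root j) = D.root i := by
    rw [h1]; simp
  generalize ha : A i j = a at hm
  generalize hb : A j i = b at hm
  cases hm <;> interval_cases n <;>
  · simp only [pow_succ, pow_zero, one_mul, Subgroup.coe_mul, LinearEquiv.mul_apply,
        simpleRefl_add, simpleRefl_add', ha, hb] at key
    rw [zero_add] at key
    have := D.root_pair_coeff hij key
    norm_num at this

/-- If the Cartan matrix of `i` and `j` is not of finite type, `s_i s_j` has infinite order. -/
theorem orderOf_eq_zero_of_four_le {i j : Fin l} (hij : i ≠ j) (hA : 4 ≤ -A i j * -A j i) :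
    orderOf (D.simpleRefl i * D.simpleRefl j) = 0 := by
  have ha := D.gcm.off_diag i j hij
  have hb := D.gcm.off_diag j i hij.symm
  have hb1 : A j i ≤ -1 := by
    by_contra! h
    rw [show A j i = 0 by omega] at hA
    omega
  -- the coefficient of `α_j` in `(s_i s_j) ^ (n + 1) α_i` stays positive
  have key (n : ℕ) : ∃ x y : ℤ, ((D.simpleRefl i * D.simpleRefl j) ^ (n + 1)).1 (D.root i) =
      0 + (x : k) • D.root i + (y : k) • D.root j ∧ 1 ≤ y ∧ 2 * y ≤ -A j i * x := by
    induction n with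
    | zero =>
      refine ⟨-A i j * -A j i - 1, -A j i, ?_, by omega, by nlinarith⟩
      have := D.simpleRefl_add' i j 0 1 0
      rw [zero_add, one_smul, zero_smul, add_zero] at this
      rw [zero_add, pow_one, Subgroup.coe_mul, LinearEquiv.mul_apply, this]
      have := D.simpleRefl_add i j 0 1 (-(A j i : k))
      simp only [LinearMap.zero_apply, neg_zero, zero_sub, sub_zero, mul_one, one_smul,
        zero_add] at this ⊢
      rw [this]
      push_cast
      module
    | succ n ih =>
      obtain ⟨x, y, h, hy, hxy⟩ := ih
      refine ⟨-x - A i j * (-y - A j i * x), -y - A j i * x, ?_, by linarith, by nlinarith⟩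
      rw [pow_succ', Subgroup.coe_mul, LinearEquiv.mul_apply, h, Subgroup.coe_mul,
        LinearEquiv.mul_apply, simpleRefl_add', simpleRefl_add]
      simp
  rw [orderOf_eq_zero_iff']
  intro n hn h1
  obtain ⟨n, rfl⟩ : ∃ n', n = n' + 1 := ⟨n - 1, by omega⟩
  obtain ⟨x, y, h, hy, -⟩ := key n
  rw [h1, zero_add] at h
  obtain ⟨-, h0⟩ := D.root_pair_coeff hij h.symm
  rw [Int.cast_eq_zero] at h0
  omega

/-- Inside the parabolic subgroup of two simple reflections, reduced alternating words which do
not start with `s_i` have an inverse which maps `α_i` to a nonnegative combination. -/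
theorem exists_altProd_inv_root {i j : Fin l} (hij : i ≠ j) {n : ℕ}
    (hn : orderOf (D.simpleRefl i * D.simpleRefl j) = 0 ∨
      n < orderOf (D.simpleRefl i * D.simpleRefl j)) :
    ∃ p q : ℕ, (altProd n (D.simpleRefl j) (D.simpleRefl i))⁻¹.1 (D.root i) =
      p • D.root i + q • D.root j := by
  suffices h : AltNonneg (-A i j) (-A j i) n 1 0 by
    simpa using D.exists_altProd_inv_apply h
  rcases finiteType_or_four_le D.gcm hij with ⟨m, hm⟩ | h4
  · rw [hm.orderOf_eq D hij] at hn
    generalize A i j = a at hm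
    generalize A j i = b at hm
    cases hm <;> rw [or_iff_right (by norm_num)] at hn <;> interval_cases n <;> decide
  · have ha := D.gcm.off_diag i j hij
    have hb := D.gcm.off_diag j i hij.symm
    exact altNonneg_of_four_le h4 (by omega) (by omega) n (by omega) le_rfl (by omega)

/-! ### Positivity of roots and descents -/

theorem eq_zero_of_mem_posCone {φ : Module.Dual k h} (h1 : φ ∈ D.posCone) (h2 : -φ ∈ D.posCone) :
    φ = 0 := by
  have key (ψ) (hψ : ψ ∈ D.posCone) : ∃ n : Fin l → ℕ, ψ = ∑ i, (n i : k) • D.root i := by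
    induction hψ using AddSubmonoid.closure_induction with
    | mem x hx =>
      obtain ⟨i, rfl⟩ := hx
      exact ⟨Pi.single i 1, by simp [Pi.single_apply]⟩
    | zero => exact ⟨0, by simp⟩
    | add x y _ _ hx hy =>
      obtain ⟨m, rfl⟩ := hx
      obtain ⟨n, rfl⟩ := hy
      exact ⟨m + n, by simp [add_smul, Finset.sum_add_distrib]⟩
  obtain ⟨m, hm⟩ := key _ h1
  obtain ⟨n, hn⟩ := key _ h2
  have h0 : ∑ i, ((m i + n i : ℕ) : k) • D.root i = 0 := by
    simp only [Nat.cast_add, add_smul, Finset.sum_add_distrib, ← hm, ← hn, add_neg_cancel]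
  have := Fintype.linearIndependent_iff.1 D.root_indep _ h0
  rw [hm]
  refine Finset.sum_eq_zero fun i _ => ?_
  have h3 : m i + n i = 0 := by exact_mod_cast this i
  rw [show m i = 0 by omega, Nat.cast_zero, zero_smul]

/-- If `s_i` is not a left descent of `w`, then `w⁻¹ α_i` is a positive root. -/
theorem inv_apply_root_mem_posCone {w : D.weylGroup} {i : Fin l}
    (hw : D.length w < D.length (D.simpleRefl i * w)) : w⁻¹.1 (D.root i) ∈ D.posCone := by
  induction hn : D.length w using Nat.strong_induction_on generalizing w i with
  | _ N ih =>
    subst hn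
    by_cases h0 : D.length w = 0
    · rw [D.eq_one_of_length_eq_zero h0]
      simpa using D.root_mem_posCone i
    obtain ⟨j, hj⟩ := D.exists_simpleRefl_mul_lt h0
    have hij : i ≠ j := by rintro rfl; omega
    obtain ⟨n, v, hn, hv, hl, hi', hj'⟩ := D.exists_eq_altProd_mul (i := i) hj
    -- an alternating word as long as the order could be rewritten to start with `s_i`
    have hlt : n < orderOf (D.simpleRefl i * D.simpleRefl j) ∨
        orderOf (D.simpleRefl i * D.simpleRefl j) = 0 := by
      by_contra! hc
      obtain ⟨hle, hm⟩ := hc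
      have hbr := D.altProd_comm_simpleRefl i j
      generalize orderOf (D.simpleRefl i * D.simpleRefl j) = m at *
      obtain ⟨n, rfl⟩ := Nat.exists_eq_add_of_le hle
      obtain ⟨m, rfl⟩ : ∃ m', m = m' + 1 := ⟨m - 1, by omega⟩
      rw [altProd_add, ← hbr, altProd_succ, mul_assoc, mul_assoc] at hv
      have h1 := congrArg (D.simpleRefl i * ·) hv
      simp only [simpleRefl_mul_cancel] at h1
      have h2 := D.length_altProd_mul_le j i m ((if Even (m + 1) then
        altProd n (D.simpleRefl j) (D.simpleRefl i) else
          altProd n (D.simpleRefl i) (D.simpleRefl j)) * v)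
      rw [← h1] at h2
      have h3 := D.length_altProd_mul_le j i n v
      have h4 := D.length_altProd_mul_le i j n v
      split_ifs at h2 <;> omega
    obtain ⟨p, q, hpq⟩ := D.exists_altProd_inv_root hij hlt.symm
    rw [hv, mul_inv_rev, Subgroup.coe_mul, LinearEquiv.mul_apply, hpq, map_add, map_nsmul,
      map_nsmul]
    exact add_mem (nsmul_mem (ih _ (by omega) hi' rfl) p) (nsmul_mem (ih _ (by omega) hj' rfl) q)

/-- If `s_i` is a left descent of `w`, then `w⁻¹ α_i` is not a positive root. -/
theorem inv_apply_root_notMem_posCone {w : D.weylGroup} {i : Fin l}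
    (hw : D.length (D.simpleRefl i * w) < D.length w) : w⁻¹.1 (D.root i) ∉ D.posCone := by
  intro hpos
  have h1 := D.inv_apply_root_mem_posCone (w := D.simpleRefl i * w) (i := i)
    (by rwa [simpleRefl_mul_cancel])
  rw [mul_inv_rev, simpleRefl_inv, Subgroup.coe_mul, LinearEquiv.mul_apply, simpleRefl_root_self,
    map_neg] at h1
  exact D.root_ne_zero i ((LinearEquiv.map_eq_zero_iff _).1 (D.eq_zero_of_mem_posCone hpos h1))

/-- If `w` has two left descents `s_i` and `s_j`, then `s_i s_j` has finite order and `w` can be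
written, with additive lengths, as a product starting with the longest element of the subgroup
generated by `s_i` and `s_j`. -/
theorem exists_eq_longest_mul {w : D.weylGroup} {i j : Fin l} (hij : i ≠ j)
    (hi : D.length (D.simpleRefl i * w) < D.length w)
    (hj : D.length (D.simpleRefl j * w) < D.length w) :
    orderOf (D.simpleRefl i * D.simpleRefl j) ≠ 0 ∧ ∃ v : D.weylGroup,
      w = altProd (orderOf (D.simpleRefl i * D.simpleRefl j)) (D.simpleRefl j) (D.simpleRefl i) *
        v ∧ D.length w = orderOf (D.simpleRefl i * D.simpleRefl j) + D.length v := by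
  obtain ⟨n, v, hn, hv, hl, hi', hj'⟩ := D.exists_eq_altProd_mul (i := i) hj
  have hle : ¬ (orderOf (D.simpleRefl i * D.simpleRefl j) = 0 ∨
      n < orderOf (D.simpleRefl i * D.simpleRefl j)) := by
    intro hlt
    obtain ⟨p, q, hpq⟩ := D.exists_altProd_inv_root hij hlt
    refine D.inv_apply_root_notMem_posCone hi ?_
    rw [hv, mul_inv_rev, Subgroup.coe_mul, LinearEquiv.mul_apply, hpq, map_add, map_nsmul,
      map_nsmul]
    exact add_mem (nsmul_mem (D.inv_apply_root_mem_posCone hi') p)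
      (nsmul_mem (D.inv_apply_root_mem_posCone hj') q)
  push Not at hle
  obtain ⟨hm, hle⟩ := hle
  refine ⟨hm, ?_⟩
  generalize orderOf (D.simpleRefl i * D.simpleRefl j) = m at *
  obtain ⟨n, rfl⟩ := Nat.exists_eq_add_of_le hle
  rw [altProd_add, mul_assoc] at hv
  refine ⟨_, hv, ?_⟩
  have h1 := D.length_altProd_mul_le j i m ((if Even m then
    altProd n (D.simpleRefl j) (D.simpleRefl i) else
      altProd n (D.simpleRefl i) (D.simpleRefl j)) * v)
  rw [← hv] at h1
  have h3 := D.length_altProd_mul_le j i n v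
  have h4 := D.length_altProd_mul_le i j n v
  split_ifs at h1 ⊢ <;> omega

end KacMoodyRealization

/-! ### Spanning by reduced words -/

section Words

variable {R C I : Type*} [CommRing R] [Ring C] [Algebra R C]

/-- The span of the products of fewer than `n` elements of the family `z`. -/
def wordSpan (R : Type*) {C I : Type*} [CommRing R] [Ring C] [Algebra R C] (z : I → C) (n : ℕ) :
    Submodule R C :=
  Submodule.span R {x | ∃ ω : List I, ω.length < n ∧ (ω.map z).prod = x}

theorem prod_mem_wordSpan (z : I → C) {n : ℕ} {ω : List I} (hω : ω.length < n) :
    (ω.map z).prod ∈ wordSpan R z n :=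
  Submodule.subset_span ⟨ω, hω, rfl⟩

theorem wordSpan_mono (z : I → C) {m n : ℕ} (hmn : m ≤ n) : wordSpan R z m ≤ wordSpan R z n := by
  refine Submodule.span_mono ?_
  rintro _ ⟨ω, hω, rfl⟩
  exact ⟨ω, hω.trans_le hmn, rfl⟩

theorem mul_mem_wordSpan (z : I → C) (i : I) {n : ℕ} {x : C} (hx : x ∈ wordSpan R z n) :
    z i * x ∈ wordSpan R z (n + 1) := by
  suffices wordSpan R z n ≤ (wordSpan R z (n + 1)).comap (LinearMap.mulLeft R (z i)) from this hx
  refine Submodule.span_le.2 ?_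
  rintro _ ⟨ω, hω, rfl⟩
  exact Submodule.subset_span ⟨i :: ω, by simpa using hω, by simp⟩

theorem mul_prod_mem_wordSpan (z : I → C) (ν : List I) {n : ℕ} {x : C}
    (hx : x ∈ wordSpan R z n) : x * (ν.map z).prod ∈ wordSpan R z (n + ν.length) := by
  suffices wordSpan R z n ≤
    (wordSpan R z (n + ν.length)).comap (LinearMap.mulRight R (ν.map z).prod) from this hx
  refine Submodule.span_le.2 ?_
  rintro _ ⟨ω, hω, rfl⟩
  exact Submodule.subset_span ⟨ω ++ ν, by simpa using hω, by simp⟩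

/-- The alternating word `i j i ⋯` with `n` letters. -/
def altWord : ℕ → I → I → List I
  | 0, _, _ => []
  | n + 1, i, j => i :: altWord n j i

theorem length_altWord (n : ℕ) (i j : I) : (altWord n i j).length = n := by
  induction n generalizing i j with
  | zero => rfl
  | succ n ih => rw [altWord, List.length_cons, ih]

theorem prod_map_altWord {M : Type*} [Monoid M] (f : I → M) (n : ℕ) (i j : I) :
    ((altWord n i j).map f).prod = altProd n (f i) (f j) := by
  induction n generalizing i j with
  | zero => rfl
  | succ n ih => rw [altWord, List.map_cons, List.prod_cons, ih, altProd]

theorem altProd_mem_wordSpan (z : I → C) {m n : ℕ} (hmn : m < n) (i j : I) :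
    altProd m (z i) (z j) ∈ wordSpan R z n := by
  rw [← prod_map_altWord]
  exact prod_mem_wordSpan z (by rwa [length_altWord])

/-- The alternating product and its corrected version agree up to shorter products. -/
theorem klProd_sub_altProd_mem (z : I → C) (n : R) (k : ℕ) (i j : I) :
    klProd n (k + 1) (z i) (z j) - altProd (k + 1) (z i) (z j) ∈ wordSpan R z (k + 1) := by
  suffices ∀ i j,
      klProd n (k + 1) (z i) (z j) - altProd (k + 1) (z i) (z j) ∈ wordSpan R z (k + 1) ∧
      klProd n k (z i) (z j) ∈ wordSpan R z (k + 1) from (this i j).1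
  clear i j
  induction k with
  | zero =>
    intro i j
    simp [klProd, altProd]
  | succ k ih =>
    intro i j
    have h1 : klProd n (k + 1) (z i) (z j) ∈ wordSpan R z (k + 2) := by
      have := add_mem (wordSpan_mono z (Nat.le_succ _) (ih i j).1)
        (altProd_mem_wordSpan (R := R) z (Nat.lt_succ_self (k + 1)) i j)
      rwa [sub_add_cancel] at this
    refine ⟨?_, h1⟩
    have h2 := mul_mem_wordSpan z i (ih j i).1
    have h3 := Submodule.smul_mem _ n (wordSpan_mono z (Nat.le_succ _) (ih i j).2)
    have := add_mem h2 h3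
    rwa [mul_sub, ← altProd_succ, sub_add_eq_add_sub, ← klProd_add_two] at this

theorem altProd_sub_altProd_mem (z : I → C) (n : R) {k : ℕ} (hk : k ≠ 0) {i j : I}
    (h : klProd n k (z i) (z j) = klProd n k (z j) (z i)) :
    altProd k (z i) (z j) - altProd k (z j) (z i) ∈ wordSpan R z k := by
  obtain ⟨k, rfl⟩ := Nat.exists_eq_succ_of_ne_zero hk
  have := sub_mem (klProd_sub_altProd_mem z n k j i) (klProd_sub_altProd_mem z n k i j)
  rwa [h, sub_sub_sub_cancel_left] at this

end Words

namespace KacMoodyRealization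

variable {k h : Type*} [Field k] [AddCommGroup h] [Module k h]
  {l : ℕ} {A : Matrix (Fin l) (Fin l) ℤ} (D : KacMoodyRealization k h A)
  {R C : Type*} [CommRing R] [Ring C] [Algebra R C]

/-- Elements `z_i` of an algebra which satisfy quadratic relations, and which satisfy the braid
relations of the Weyl group up to products of smaller length. -/
structure QuasiBraid (q : R) (z : Fin l → C) : Prop where
  sq : ∀ i, z i * z i = q • z i
  braid : ∀ i j, i ≠ j → orderOf (D.simpleRefl i * D.simpleRefl j) ≠ 0 →
    altProd (orderOf (D.simpleRefl i * D.simpleRefl j)) (z i) (z j) -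
      altProd (orderOf (D.simpleRefl i * D.simpleRefl j)) (z j) (z i) ∈
        wordSpan R z (orderOf (D.simpleRefl i * D.simpleRefl j))

variable {D} {q : R} {z : Fin l → C}

theorem wordProd_altWord (n : ℕ) (i j : Fin l) :
    D.wordProd (altWord n i j) = altProd n (D.simpleRefl i) (D.simpleRefl j) :=
  prod_map_altWord _ n i j

variable (D) in
/-- A reduced word of an element of the Weyl group. -/
def reducedWord (w : D.weylGroup) : List (Fin l) := (D.exists_reduced_word w).choose

theorem wordProd_reducedWord (w : D.weylGroup) : D.wordProd (D.reducedWord w) = w :=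
  (D.exists_reduced_word w).choose_spec.1

theorem length_reducedWord (w : D.weylGroup) : (D.reducedWord w).length = D.length w :=
  (D.exists_reduced_word w).choose_spec.2

variable [CharZero k]

/-- Products over two reduced words of the same element agree up to shorter products. This is
Matsumoto's theorem, weakened to allow for lower order terms in the braid relations. -/
theorem QuasiBraid.prod_sub_prod_mem (hz : D.QuasiBraid q z) {n : ℕ} {ω ω' : List (Fin l)}
    (hω : ω.length = n) (hω' : ω'.length = n) (hl : D.length (D.wordProd ω) = n)
    (heq : D.wordProd ω = D.wordProd ω') :
    (ω.map z).prod - (ω'.map z).prod ∈ wordSpan R z n := by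
  induction n generalizing ω ω' with
  | zero =>
    rw [List.length_eq_zero_iff.1 hω, List.length_eq_zero_iff.1 hω', sub_self]
    exact zero_mem _
  | succ n ih =>
    obtain ⟨i, ω, rfl⟩ := List.exists_of_length_succ ω hω
    obtain ⟨j, ω', rfl⟩ := List.exists_of_length_succ ω' hω'
    rw [List.length_cons, Nat.add_right_cancel_iff] at hω hω'
    have hi : D.length (D.wordProd ω) = n := by
      have := D.length_wordProd_le ω
      have := D.length_simpleRefl_mul_le i (D.wordProd ω)
      rw [wordProd_cons] at hl
      omega
    have hj : D.length (D.wordProd ω') = n := by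
      have := D.length_wordProd_le ω'
      have := D.length_simpleRefl_mul_le j (D.wordProd ω')
      rw [heq, wordProd_cons] at hl
      omega
    simp only [List.map_cons, List.prod_cons]
    rcases eq_or_ne i j with rfl | hij
    · rw [← mul_sub]
      rw [wordProd_cons, wordProd_cons, mul_right_inj] at heq
      exact mul_mem_wordSpan z i (ih hω hω' hi heq)
    have hiw : D.simpleRefl i * D.wordProd (i :: ω) = D.wordProd ω := by
      rw [wordProd_cons, simpleRefl_mul_cancel]
    have hjw : D.simpleRefl j * D.wordProd (i :: ω) = D.wordProd ω' := by
      rw [heq, wordProd_cons, simpleRefl_mul_cancel]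
    obtain ⟨hm, v, hv, hlv⟩ := D.exists_eq_longest_mul (w := D.wordProd (i :: ω)) hij
      (by rw [hiw]; omega) (by rw [hjw]; omega)
    have hbr := D.altProd_comm_simpleRefl i j
    have hzb := hz.braid i j hij hm
    generalize orderOf (D.simpleRefl i * D.simpleRefl j) = m at *
    obtain ⟨m, rfl⟩ := Nat.exists_eq_succ_of_ne_zero hm
    obtain ⟨ν, rfl, hν⟩ := D.exists_reduced_word v
    have hlen : m + ν.length = n := by omega
    -- compare `ω` and `ω'` with the two words which start with a reduced word of the longest element
    have h1 := ih hω (ω' := altWord m j i ++ ν)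
      (by rw [List.length_append, length_altWord, hlen]) hi (by
        rw [← hiw, hv, wordProd_append, wordProd_altWord, ← hbr, altProd_succ, mul_assoc,
          simpleRefl_mul_cancel])
    have h2 := ih hω' (ω' := altWord m i j ++ ν)
      (by rw [List.length_append, length_altWord, hlen]) hj (by
        rw [← hjw, hv, wordProd_append, wordProd_altWord, altProd_succ, mul_assoc,
          simpleRefl_mul_cancel])
    have h3 := mul_prod_mem_wordSpan z ν hzb
    rw [show m.succ + ν.length = n + 1 by omega] at h3
    have := add_mem (sub_mem (mul_mem_wordSpan z i h1) (mul_mem_wordSpan z j h2)) h3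
    convert this using 1
    simp only [List.map_append, List.prod_append, prod_map_altWord, altProd_succ]
    noncomm_ring

/-- Products over words which are not reduced are linear combinations of shorter products. -/
theorem QuasiBraid.prod_mem_of_length_lt (hz : D.QuasiBraid q z) {ω : List (Fin l)}
    (hω : D.length (D.wordProd ω) < ω.length) :
    (ω.map z).prod ∈ wordSpan R z ω.length := by
  induction ω with
  | nil => simp at hω
  | cons i ω ih =>
    rw [List.length_cons, List.map_cons, List.prod_cons]
    rcases (D.length_wordProd_le ω).lt_or_eq with hlt | heq
    · exact mul_mem_wordSpan z i (ih hlt)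
    rw [wordProd_cons, List.length_cons] at hω
    obtain ⟨ν, hν, hν'⟩ := D.exists_reduced_word (D.simpleRefl i * D.wordProd ω)
    have hlen : ν.length + 1 = ω.length := by
      rcases D.length_simpleRefl_mul_cases i (D.wordProd ω) with h | h <;> omega
    -- `ω` is reduced, so it may be exchanged for a reduced word that starts with `i`
    have h1 := hz.prod_sub_prod_mem (ω := ω) (ω' := i :: ν) rfl hlen heq (by
      rw [wordProd_cons, hν, simpleRefl_mul_cancel])
    have h2 := mul_mem_wordSpan z i h1
    rw [List.map_cons, List.prod_cons, mul_sub, ← mul_assoc (z i) (z i), hz.sq, smul_mul_assoc] at h2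
    have h3 : q • (z i * (ν.map z).prod) ∈ wordSpan R z (ω.length + 1) := by
      refine Submodule.smul_mem _ _ ?_
      have := prod_mem_wordSpan (R := R) z (n := ω.length + 1) (ω := i :: ν) (by simp [hlen])
      simpa using this
    simpa using add_mem h2 h3

theorem QuasiBraid.prod_mem_span (hz : D.QuasiBraid q z) (ω : List (Fin l)) :
    (ω.map z).prod ∈
      Submodule.span R (Set.range fun w : D.weylGroup => ((D.reducedWord w).map z).prod) := by
  induction hn : ω.length using Nat.strong_induction_on generalizing ω with
  | _ N ih =>
    subst hn
    have hle : wordSpan R z ω.length ≤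
        Submodule.span R (Set.range fun w : D.weylGroup => ((D.reducedWord w).map z).prod) := by
      refine Submodule.span_le.2 ?_
      rintro _ ⟨ν, hν, rfl⟩
      exact ih _ hν ν rfl
    rcases (D.length_wordProd_le ω).lt_or_eq with hlt | heq
    · exact hle (hz.prod_mem_of_length_lt hlt)
    · have h1 := hle (hz.prod_sub_prod_mem (ω := ω) (ω' := D.reducedWord (D.wordProd ω)) rfl
        (by rw [length_reducedWord, heq]) heq (wordProd_reducedWord _).symm)
      have h2 : ((D.reducedWord (D.wordProd ω)).map z).prod ∈ Submodule.span R
          (Set.range fun w : D.weylGroup => ((D.reducedWord w).map z).prod) :=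
        Submodule.subset_span ⟨_, rfl⟩
      simpa using add_mem h1 h2

/-- The subalgebra generated by the `z_i` is spanned by one product for each element of the Weyl
group. -/
theorem QuasiBraid.adjoin_le_span (hz : D.QuasiBraid q z) {x : C}
    (hx : x ∈ Algebra.adjoin R (Set.range z)) :
    x ∈ Submodule.span R (Set.range fun w : D.weylGroup => ((D.reducedWord w).map z).prod) := by
  rw [← Subalgebra.mem_toSubmodule, Algebra.adjoin_eq_span] at hx
  refine Submodule.span_le.2 ?_ hx
  intro y hy
  obtain ⟨L, hL, rfl⟩ := Submonoid.exists_list_of_mem_closure hy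
  obtain ⟨ω, rfl⟩ : ∃ ω : List (Fin l), ω.map z = L := by
    have : L ∈ Set.range (List.map z) := by rw [Set.range_list_map]; exact hL
    exact this
  exact hz.prod_mem_span ω

end KacMoodyRealization

/-! ### Linear independence of products of Demazure elements -/

section Independence

variable {k h : Type*} [Field k] [AddCommGroup h] [Module k h]
  {l : ℕ} {A : Matrix (Fin l) (Fin l) ℤ} {D : KacMoodyRealization k h A}
  (L : FormalDemazureLattice D) {R : Type*} [CommRing R] (F : MvPowerSeries (Fin 2) R)

theorem isUnit_invSimpleRoot (i : Fin l) : IsUnit (invSimpleRoot L F i) := by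
  refine IsUnit.of_mul_eq_one (algebraMap _ (QF L F) (xElt F (L.simpleRoot i))) ?_
  rw [invSimpleRoot, mul_comm]
  exact (IsLocalization.mk'_spec' (QF L F) 1 _).trans (map_one _)

theorem coeff_demazureElement_mul (i : Fin l) (f : TwistedAlgebra L F) (w : D.weylGroup) :
    (demazureElement L F i * f).coeff w = invSimpleRoot L F i *
      (f.coeff w - D.simpleRefl i • f.coeff (D.simpleRefl i * w)) := by
  rw [demazureElement, mul_assoc, SkewMonoidAlgebra.coeff_single_one_mul, sub_mul, one_mul,
    SkewMonoidAlgebra.coeff_sub, Finsupp.sub_apply,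
    SkewMonoidAlgebra.coeff_single_mul_aux (z := D.simpleRefl i * w), one_mul]
  intro a
  constructor
  · rintro rfl; rw [D.simpleRefl_mul_cancel]
  · rintro rfl; rw [D.simpleRefl_mul_cancel]

/-- Products of Demazure elements are triangular with respect to the basis `δ_w`. -/
theorem coeff_prod_demazureElement (ω : List (Fin l)) (w : D.weylGroup)
    (hw : ω.length ≤ D.length w) :
    (w ≠ D.wordProd ω → ((ω.map (demazureElement L F)).prod).coeff w = 0) ∧
      (w = D.wordProd ω → IsUnit (((ω.map (demazureElement L F)).prod).coeff w)) := by
  induction ω generalizing w with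
  | nil =>
    simp only [List.map_nil, List.prod_nil, SkewMonoidAlgebra.coeff_one, D.wordProd_nil]
    refine ⟨fun h => by rw [Finsupp.single_eq_of_ne h], ?_⟩
    rintro rfl
    simp
  | cons i ω ih =>
    rw [List.length_cons] at hw
    have h1 : ((ω.map (demazureElement L F)).prod).coeff w = 0 := by
      refine (ih w (by omega)).1 ?_
      rintro rfl
      have := D.length_wordProd_le ω
      omega
    have h2 := ih (D.simpleRefl i * w) (by
      have := D.length_le_simpleRefl_mul i w
      omega)
    rw [List.map_cons, List.prod_cons, coeff_demazureElement_mul, h1, zero_sub, D.wordProd_cons]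
    constructor
    · intro hne
      rw [h2.1, smul_zero, neg_zero, mul_zero]
      intro heq
      exact hne (by rw [← heq, D.simpleRefl_mul_cancel])
    · rintro rfl
      refine (isUnit_invSimpleRoot L F i).mul (IsUnit.neg ?_)
      exact (h2.2 (D.simpleRefl_mul_cancel _ _)).map
        (MulSemiringAction.toRingHom D.weylGroup (QF L F) (D.simpleRefl i))

/-- If `R` embeds into `Q^F`, the products of Demazure elements over a system of reduced words are
linearly independent. -/
theorem linearIndependent_demazure (hinj : Function.Injective (algebraMap R (QF L F))) :
    LinearIndependent R fun w : D.weylGroup =>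
      ((D.reducedWord w).map (demazureElement L F)).prod := by
  classical
  rw [linearIndependent_iff]
  intro c hc
  by_contra hne
  -- compare coefficients of `δ_w` for `w` of maximal length in the support
  obtain ⟨w, hw, hmax⟩ := c.support.exists_max_image D.length (Finsupp.support_nonempty_iff.2 hne)
  have h1 := congrArg (fun f => SkewMonoidAlgebra.coeff f w) hc
  simp only [Finsupp.linearCombination_apply, Finsupp.sum] at h1
  have h2 : ∀ (s : Finset D.weylGroup) (g : D.weylGroup → TwistedAlgebra L F),
      (∑ v ∈ s, g v).coeff w = ∑ v ∈ s, (g v).coeff w := by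
    intro s g
    induction s using Finset.induction_on with
    | empty => simp
    | insert a s ha ih => rw [Finset.sum_insert ha, Finset.sum_insert ha, ← ih]; simp
  rw [h2, Finset.sum_eq_single w] at h1
  · have h3 := (coeff_prod_demazureElement L F (D.reducedWord w) w (by
      rw [D.length_reducedWord])).2 (D.wordProd_reducedWord w).symm
    rw [SkewMonoidAlgebra.coeff_smul, Finsupp.smul_apply, Algebra.smul_def,
      SkewMonoidAlgebra.coeff_zero, Finsupp.zero_apply, h3.mul_left_eq_zero] at h1
    exact Finsupp.mem_support_iff.1 hw (hinj (by rw [h1, map_zero]))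
  · intro v hv hvw
    rw [SkewMonoidAlgebra.coeff_smul, Finsupp.smul_apply,
      (coeff_prod_demazureElement L F (D.reducedWord v) w (by
        rw [D.length_reducedWord]; exact hmax v hv)).1
        (by rw [D.wordProd_reducedWord]; exact hvw.symm), smul_zero]
  · intro h; exact absurd hw h

end Independence

/-! ### The hyperbolic formal group law -/

section Evaluation

variable {R M : Type*} [CommRing R]

theorem hyperbolicFGL_mul (μ₁ μ₂ : R) :
    hyperbolicFGL μ₁ μ₂ +
        MvPowerSeries.C μ₂ * (MvPowerSeries.X 0 * MvPowerSeries.X 1 * hyperbolicFGL μ₁ μ₂) =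
      MvPowerSeries.X 0 + MvPowerSeries.X 1 -
        MvPowerSeries.C μ₁ * (MvPowerSeries.X 0 * MvPowerSeries.X 1 * 1) := by
  have h := MvPowerSeries.mul_invOfUnit
    (1 + MvPowerSeries.C μ₂ * (MvPowerSeries.X 0 * MvPowerSeries.X 1) :
      MvPowerSeries (Fin 2) R) 1 (by simp)
  rw [hyperbolicFGL]
  linear_combination (MvPowerSeries.X 0 + MvPowerSeries.X 1
      - MvPowerSeries.C μ₁ * (MvPowerSeries.X 0 * MvPowerSeries.X 1)) * h

theorem partialSum_add (F G : MvPowerSeries (Fin 2) R) (a b : M) (n : ℕ) :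
    partialSum (F + G) a b n = partialSum F a b n + partialSum G a b n := by
  simp only [partialSum, map_add, add_mul, Finset.sum_add_distrib]

theorem partialSum_sub (F G : MvPowerSeries (Fin 2) R) (a b : M) (n : ℕ) :
    partialSum (F - G) a b n = partialSum F a b n - partialSum G a b n := by
  simp only [partialSum, map_sub, sub_mul, Finset.sum_sub_distrib]

theorem partialSum_C_mul (r : R) (F : MvPowerSeries (Fin 2) R) (a b : M) (n : ℕ) :
    partialSum (MvPowerSeries.C r * F) a b n = MvPolynomial.C r * partialSum F a b n := by
  simp only [partialSum, MvPowerSeries.coeff_C_mul, map_mul, Finset.mul_sum, mul_assoc]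

theorem partialSum_X_mul_X_mul (F : MvPowerSeries (Fin 2) R) (a b : M) (n : ℕ) :
    partialSum (MvPowerSeries.X 0 * MvPowerSeries.X 1 * F) a b (n + 1) =
      MvPolynomial.X a * MvPolynomial.X b * partialSum F a b n := by
  have hX : (MvPowerSeries.X 0 * MvPowerSeries.X 1 : MvPowerSeries (Fin 2) R) =
      MvPowerSeries.monomial (Finsupp.single 0 1 + Finsupp.single 1 1) 1 := by
    rw [MvPowerSeries.X, MvPowerSeries.X, MvPowerSeries.monomial_mul_monomial, one_mul]
  have h0 : ∀ m : Fin 2 →₀ ℕ, (m 0 = 0 ∨ m 1 = 0) →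
      MvPowerSeries.coeff m (MvPowerSeries.X 0 * MvPowerSeries.X 1 * F) = 0 := by
    intro m hm
    rw [hX, MvPowerSeries.coeff_monomial_mul, if_neg]
    intro hle
    have h1 := hle 0
    have h2 := hle 1
    simp at h1 h2
    omega
  have h1 : ∀ i j : ℕ, MvPowerSeries.coeff (Finsupp.single 0 (i + 1) + Finsupp.single 1 (j + 1))
      (MvPowerSeries.X 0 * MvPowerSeries.X 1 * F) =
      MvPowerSeries.coeff (Finsupp.single 0 i + Finsupp.single 1 j) F := by
    intro i j
    have : (Finsupp.single 0 (i + 1) + Finsupp.single 1 (j + 1) : Fin 2 →₀ ℕ) =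
        (Finsupp.single 0 1 + Finsupp.single 1 1) + (Finsupp.single 0 i + Finsupp.single 1 j) := by
      rw [Finsupp.single_add, Finsupp.single_add]
      abel
    rw [hX, this, MvPowerSeries.coeff_add_monomial_mul, one_mul]
  simp only [partialSum]
  rw [Finset.sum_range_succ']
  simp_rw [Finset.sum_range_succ' _ n]
  simp only [h1]
  simp (disch := simp) only [h0]
  simp only [map_zero, zero_mul, Finset.sum_const_zero, add_zero, Finset.mul_sum]
  refine Finset.sum_congr rfl fun i _ => Finset.sum_congr rfl fun j _ => ?_
  ring

theorem single_add_single_eq_iff {i j i' j' : ℕ} :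
    (Finsupp.single 0 i + Finsupp.single 1 j : Fin 2 →₀ ℕ) =
      Finsupp.single 0 i' + Finsupp.single 1 j' ↔ i = i' ∧ j = j' := by
  refine ⟨fun h => ⟨?_, ?_⟩, ?_⟩
  · simpa using DFunLike.congr_fun h 0
  · simpa using DFunLike.congr_fun h 1
  · rintro ⟨rfl, rfl⟩; rfl

theorem partialSum_monomial (a b : M) {i j n : ℕ} (hi : i < n) (hj : j < n) :
    partialSum (MvPowerSeries.monomial (Finsupp.single 0 i + Finsupp.single 1 j) (1 : R)) a b n =
      MvPolynomial.X a ^ i * MvPolynomial.X b ^ j := by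
  classical
  simp only [partialSum, MvPowerSeries.coeff_monomial, single_add_single_eq_iff]
  rw [Finset.sum_eq_single i, Finset.sum_eq_single j]
  · simp
  · intro j' _ h; simp [h]
  · intro h; simp at h; omega
  · intro i' _ h; simp [h]
  · intro h; simp at h; omega

theorem mk_partialSum_succ (F : MvPowerSeries (Fin 2) R) (a b : M) {m n : ℕ} (hmn : m ≤ n) :
    Ideal.Quotient.mk (augIdeal R M ^ m) (partialSum F a b (n + 1)) =
      Ideal.Quotient.mk (augIdeal R M ^ m) (partialSum F a b n) := by
  have h := (partialSum_cauchy F a b n).symm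
  rw [SModEq.sub_mem, smul_eq_mul, Ideal.mul_top] at h
  exact Ideal.Quotient.eq.2 (Ideal.pow_le_pow_right hmn h)

/-- The defining property of the hyperbolic formal group law, evaluated in the completion. -/
theorem fglEval_hyperbolicFGL_mul (μ₁ μ₂ : R) (a b : M) :
    fglEval (hyperbolicFGL μ₁ μ₂) a b *
        (1 + algebraMap R (PowerSeriesCompletion R M) μ₂ * (complX a * complX b)) =
      complX a + complX b - algebraMap R _ μ₁ * (complX a * complX b) := by
  refine AdicCompletion.ext_evalₐ fun n => ?_
  have hX0 : (MvPowerSeries.X 0 : MvPowerSeries (Fin 2) R) =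
      MvPowerSeries.monomial (Finsupp.single 0 1 + Finsupp.single 1 0) 1 := by
    simp [MvPowerSeries.X]
  have hX1 : (MvPowerSeries.X 1 : MvPowerSeries (Fin 2) R) =
      MvPowerSeries.monomial (Finsupp.single 0 0 + Finsupp.single 1 1) 1 := by
    simp [MvPowerSeries.X]
  have h1 : (1 : MvPowerSeries (Fin 2) R) =
      MvPowerSeries.monomial (Finsupp.single 0 0 + Finsupp.single 1 0) 1 := by
    simp
  -- with `n + 2` terms in each variable, the partial sums of `X 0` and `X 1` are exact for all `n`
  have h := congrArg (fun G => Ideal.Quotient.mk (augIdeal R M ^ n) (partialSum G a b (n + 1 + 1)))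
    (hyperbolicFGL_mul μ₁ μ₂)
  simp only [partialSum_add, partialSum_sub, partialSum_C_mul, partialSum_X_mul_X_mul] at h
  rw [hX0, hX1, h1, partialSum_monomial a b (by omega) (by omega),
    partialSum_monomial a b (by omega) (by omega),
    partialSum_monomial a b (by omega) (by omega)] at h
  simp only [map_add, map_mul, map_sub, pow_zero, pow_one, mul_one, one_mul,
    mk_partialSum_succ (hyperbolicFGL μ₁ μ₂) a b (le_refl n),
    mk_partialSum_succ (hyperbolicFGL μ₁ μ₂) a b (Nat.le_succ n)] at h
  have hC : ∀ r : R, AdicCompletion.evalₐ (augIdeal R M) n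
      (algebraMap R (PowerSeriesCompletion R M) r) =
        Ideal.Quotient.mk (augIdeal R M ^ n) (MvPolynomial.C r) := by
    intro r
    rw [AdicCompletion.algebraMap_apply, AdicCompletion.evalₐ_of]
    rfl
  have hF : AdicCompletion.evalₐ (augIdeal R M) n (fglEval (hyperbolicFGL μ₁ μ₂) a b) =
      Ideal.Quotient.mk (augIdeal R M ^ n) (partialSum (hyperbolicFGL μ₁ μ₂) a b n) :=
    AdicCompletion.evalₐ_mk _ _ _
  simp only [map_add, map_mul, map_sub, hC, hF, complX, AdicCompletion.evalₐ_of, mul_add, mul_one]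
  rw [← h]
  ring

end Evaluation

section Algebra

variable {R M : Type*} [CommRing R] [AddCommGroup M]

theorem fglIdeal_le_closure (F : MvPowerSeries (Fin 2) R) :
    fglIdeal M F ≤ fglIdealClosure M F := le_iInf fun _ => le_sup_left

theorem xElt_zero (F : MvPowerSeries (Fin 2) R) : xElt F (0 : M) = 0 :=
  Ideal.Quotient.eq_zero_iff_mem.2 (fglIdeal_le_closure F (Ideal.subset_span (Or.inl rfl)))

theorem xElt_add (F : MvPowerSeries (Fin 2) R) (a b : M) :
    xElt F (a + b) = Ideal.Quotient.mk (fglIdealClosure M F) (fglEval F a b) :=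
  Ideal.Quotient.eq.2 (fglIdeal_le_closure F (Ideal.subset_span (Or.inr ⟨(a, b), rfl⟩)))

theorem xElt_add_mul (μ₁ μ₂ : R) (a b : M) :
    xElt (hyperbolicFGL μ₁ μ₂) (a + b) * (1 + algebraMap R _ μ₂ *
        (xElt (hyperbolicFGL μ₁ μ₂) a * xElt (hyperbolicFGL μ₁ μ₂) b)) =
      xElt (hyperbolicFGL μ₁ μ₂) a + xElt (hyperbolicFGL μ₁ μ₂) b -
        algebraMap R _ μ₁ * (xElt (hyperbolicFGL μ₁ μ₂) a * xElt (hyperbolicFGL μ₁ μ₂) b) := by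
  rw [xElt_add]
  exact congrArg (Ideal.Quotient.mk (fglIdealClosure M (hyperbolicFGL μ₁ μ₂)))
    (fglEval_hyperbolicFGL_mul μ₁ μ₂ a b)

end Algebra

/-! ### Inverses of the root elements -/

section InverseRoots

variable {k h : Type*} [Field k] [AddCommGroup h] [Module k h]
  {l : ℕ} {A : Matrix (Fin l) (Fin l) ℤ} {D : KacMoodyRealization k h A}
  (L : FormalDemazureLattice D) {R : Type*} [CommRing R] (F : MvPowerSeries (Fin 2) R)

/-- The element `1 / x_a` of `Q^F` for a real root `a`; it is zero if `x_a` is not invertible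
in `Q^F`. -/
def invRoot (a : L.carrier) : QF L F :=
  Ring.inverse (algebraMap (FormalGroupAlgebra L.carrier F) (QF L F) (xElt F a))

variable {L}

theorem isUnit_algebraMap_xElt {a : L.carrier} (ha : (a : Module.Dual k h) ∈ D.realRoots) :
    IsUnit (algebraMap (FormalGroupAlgebra L.carrier F) (QF L F) (xElt F a)) :=
  IsLocalization.map_units (QF L F) (⟨_, Submonoid.subset_closure ⟨a, ha, rfl⟩⟩ : rootSubmonoid L F)

theorem invRoot_mul {a : L.carrier} (ha : (a : Module.Dual k h) ∈ D.realRoots) :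
    invRoot L F a * algebraMap (FormalGroupAlgebra L.carrier F) (QF L F) (xElt F a) = 1 :=
  Ring.inverse_mul_cancel _ (isUnit_algebraMap_xElt F ha)

theorem invRoot_simpleRoot (i : Fin l) : invRoot L F (L.simpleRoot i) = invSimpleRoot L F i := by
  have h1 : (L.simpleRoot i : Module.Dual k h) ∈ D.realRoots := ⟨1, i, rfl⟩
  have h2 : invSimpleRoot L F i *
      algebraMap (FormalGroupAlgebra L.carrier F) (QF L F) (xElt F (L.simpleRoot i)) = 1 :=
    (IsLocalization.mk'_spec (QF L F) 1 _).trans (map_one _)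
  exact (isUnit_algebraMap_xElt F h1).mul_right_cancel ((invRoot_mul F h1).trans h2.symm)

theorem weylAct_mem_realRoots (w : D.weylGroup) {a : L.carrier}
    (ha : (a : Module.Dual k h) ∈ D.realRoots) :
    (L.weylAct w a : Module.Dual k h) ∈ D.realRoots := by
  obtain ⟨v, i, hv⟩ := ha
  refine ⟨w * v, i, ?_⟩
  change w.1 a.1 = w.1 (v.1 (D.root i))
  rw [hv]

theorem weylQF_invRoot (w : D.weylGroup) {a : L.carrier}
    (ha : (a : Module.Dual k h) ∈ D.realRoots) :
    weylQF L F w (invRoot L F a) = invRoot L F (L.weylAct w a) := by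
  refine (isUnit_algebraMap_xElt F (weylAct_mem_realRoots w ha)).mul_right_cancel ?_
  rw [invRoot_mul F (weylAct_mem_realRoots w ha), ← fgaMap_xElt, ← weylQF_algebraMap, ← map_mul,
    invRoot_mul F ha, map_one]

/-- The action of an element of the Weyl group on `Q^F`, as an `R`-algebra homomorphism. -/
def weylQFHom (w : D.weylGroup) : QF L F →ₐ[R] QF L F :=
  { weylQF L F w with
    commutes' := fun r => by
      have h := smul_comm w r (1 : QF L F)
      rw [smul_one, ← Algebra.algebraMap_eq_smul_one] at h
      exact h }

theorem weylQFHom_apply (w : D.weylGroup) (x : QF L F) : weylQFHom F w x = w • x := rfl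

theorem weylQFHom_invRoot (w : D.weylGroup) {a : L.carrier}
    (ha : (a : Module.Dual k h) ∈ D.realRoots) :
    weylQFHom F w (invRoot L F a) = invRoot L F (L.weylAct w a) := weylQF_invRoot F w ha

/-- The formal group law in terms of the inverses `1 / x_a`. -/
theorem invRoot_add (μ₁ μ₂ : R) {a b c : L.carrier} (ha : (a : Module.Dual k h) ∈ D.realRoots)
    (hb : (b : Module.Dual k h) ∈ D.realRoots) (hc : (c : Module.Dual k h) ∈ D.realRoots)
    (habc : c = a + b) :
    invRoot L (hyperbolicFGL μ₁ μ₂) a * invRoot L (hyperbolicFGL μ₁ μ₂) b +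
        algebraMap R (QF L (hyperbolicFGL μ₁ μ₂)) μ₂ =
      invRoot L (hyperbolicFGL μ₁ μ₂) c * (invRoot L (hyperbolicFGL μ₁ μ₂) a +
        invRoot L (hyperbolicFGL μ₁ μ₂) b - algebraMap R _ μ₁) := by
  have h := congrArg (algebraMap (FormalGroupAlgebra L.carrier (hyperbolicFGL μ₁ μ₂))
    (QF L (hyperbolicFGL μ₁ μ₂))) (xElt_add_mul μ₁ μ₂ a b)
  rw [← habc] at h
  simp only [map_add, map_mul, map_sub, map_one, ← IsScalarTower.algebraMap_apply] at h
  have h1 := invRoot_mul (hyperbolicFGL μ₁ μ₂) ha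
  have h2 := invRoot_mul (hyperbolicFGL μ₁ μ₂) hb
  have h3 := invRoot_mul (hyperbolicFGL μ₁ μ₂) hc
  generalize invRoot L (hyperbolicFGL μ₁ μ₂) a = p at *
  generalize invRoot L (hyperbolicFGL μ₁ μ₂) b = q at *
  generalize invRoot L (hyperbolicFGL μ₁ μ₂) c = r at *
  generalize algebraMap (FormalGroupAlgebra L.carrier (hyperbolicFGL μ₁ μ₂))
    (QF L (hyperbolicFGL μ₁ μ₂)) (xElt (hyperbolicFGL μ₁ μ₂) a) = x at *
  generalize algebraMap (FormalGroupAlgebra L.carrier (hyperbolicFGL μ₁ μ₂))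
    (QF L (hyperbolicFGL μ₁ μ₂)) (xElt (hyperbolicFGL μ₁ μ₂) b) = y at *
  generalize algebraMap (FormalGroupAlgebra L.carrier (hyperbolicFGL μ₁ μ₂))
    (QF L (hyperbolicFGL μ₁ μ₂)) (xElt (hyperbolicFGL μ₁ μ₂) c) = z at *
  grind

theorem invRoot_neg (μ₁ μ₂ : R) {a : L.carrier} (ha : (a : Module.Dual k h) ∈ D.realRoots)
    (hna : ((-a : L.carrier) : Module.Dual k h) ∈ D.realRoots) :
    invRoot L (hyperbolicFGL μ₁ μ₂) (-a) =
      algebraMap R _ μ₁ - invRoot L (hyperbolicFGL μ₁ μ₂) a := by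
  have h := congrArg (algebraMap (FormalGroupAlgebra L.carrier (hyperbolicFGL μ₁ μ₂))
    (QF L (hyperbolicFGL μ₁ μ₂))) (xElt_add_mul μ₁ μ₂ a (-a))
  rw [add_neg_cancel, xElt_zero, zero_mul, map_zero] at h
  simp only [map_add, map_mul, map_sub, ← IsScalarTower.algebraMap_apply] at h
  have h1 := invRoot_mul (hyperbolicFGL μ₁ μ₂) ha
  have h2 := invRoot_mul (hyperbolicFGL μ₁ μ₂) hna
  generalize invRoot L (hyperbolicFGL μ₁ μ₂) a = p at *
  generalize invRoot L (hyperbolicFGL μ₁ μ₂) (-a) = q at *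
  generalize algebraMap (FormalGroupAlgebra L.carrier (hyperbolicFGL μ₁ μ₂))
    (QF L (hyperbolicFGL μ₁ μ₂)) (xElt (hyperbolicFGL μ₁ μ₂) a) = x at *
  generalize algebraMap (FormalGroupAlgebra L.carrier (hyperbolicFGL μ₁ μ₂))
    (QF L (hyperbolicFGL μ₁ μ₂)) (xElt (hyperbolicFGL μ₁ μ₂) (-a)) = y at *
  grind

end InverseRoots

/-! ### Specializations of the formal group algebra to power series -/

section HyperbolicGroup

open PowerSeries

/-- The group of points of the hyperbolic formal group law in `X P⟦X⟧`: the power series without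
constant term, under `(x, y) ↦ F(x, y)`. -/
def HyperbolicGroup {P : Type*} [CommRing P] (_μ₁ _μ₂ : P) : Type _ :=
  {x : P⟦X⟧ // constantCoeff x = 0}

namespace HyperbolicGroup

variable {P : Type*} [CommRing P] {μ₁ μ₂ : P}

/-- The power series underlying a point of the hyperbolic formal group law. -/
def toSeries (x : HyperbolicGroup μ₁ μ₂) : P⟦X⟧ := x.1

@[ext]
theorem ext {x y : HyperbolicGroup μ₁ μ₂} (h : x.toSeries = y.toSeries) : x = y := Subtype.ext h

theorem constantCoeff_toSeries (x : HyperbolicGroup μ₁ μ₂) : constantCoeff x.toSeries = 0 := x.2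

theorem isUnit_one_add {f : P⟦X⟧} (hf : constantCoeff f = 0) : IsUnit (1 + f) := by
  rw [PowerSeries.isUnit_iff_constantCoeff]
  simp [hf]

instance : Zero (HyperbolicGroup μ₁ μ₂) := ⟨⟨0, map_zero _⟩⟩

instance : Add (HyperbolicGroup μ₁ μ₂) :=
  ⟨fun x y => ⟨(x.toSeries + y.toSeries - C μ₁ * (x.toSeries * y.toSeries)) *
    Ring.inverse (1 + C μ₂ * (x.toSeries * y.toSeries)), by
      simp [constantCoeff_toSeries]⟩⟩

instance : Neg (HyperbolicGroup μ₁ μ₂) :=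
  ⟨fun x => ⟨-x.toSeries * Ring.inverse (1 + -(C μ₁ * x.toSeries)), by
      simp [constantCoeff_toSeries]⟩⟩

theorem toSeries_zero : (0 : HyperbolicGroup μ₁ μ₂).toSeries = 0 := rfl

theorem isUnit_denom (x y : HyperbolicGroup μ₁ μ₂) :
    IsUnit (1 + C μ₂ * (x.toSeries * y.toSeries)) :=
  isUnit_one_add (by simp [constantCoeff_toSeries])

theorem toSeries_add (x y : HyperbolicGroup μ₁ μ₂) :
    (x + y).toSeries * (1 + C μ₂ * (x.toSeries * y.toSeries)) =
      x.toSeries + y.toSeries - C μ₁ * (x.toSeries * y.toSeries) := by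
  change _ * Ring.inverse _ * _ = _
  rw [mul_assoc, Ring.inverse_mul_cancel _ (isUnit_denom x y), mul_one]

theorem toSeries_neg (x : HyperbolicGroup μ₁ μ₂) :
    (-x).toSeries * (1 + -(C μ₁ * x.toSeries)) = -x.toSeries := by
  change _ * Ring.inverse _ * _ = _
  rw [mul_assoc, Ring.inverse_mul_cancel _ (isUnit_one_add (by simp [constantCoeff_toSeries])),
    mul_one]

instance : AddCommGroup (HyperbolicGroup μ₁ μ₂) where
  add_assoc x y z := by
    ext1
    -- both sums, cleared of denominators, have the same symmetric numerator and denominator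
    have hu : IsUnit (1 + C μ₂ * (x.toSeries * y.toSeries + y.toSeries * z.toSeries +
        x.toSeries * z.toSeries - C μ₁ * (x.toSeries * y.toSeries * z.toSeries))) :=
      isUnit_one_add (by simp [constantCoeff_toSeries])
    refine hu.mul_right_cancel ?_
    have h1 := toSeries_add x y
    have h2 := toSeries_add (x + y) z
    have h3 := toSeries_add y z
    have h4 := toSeries_add x (y + z)
    linear_combination (1 + C μ₂ * (x.toSeries * y.toSeries)) * h2 -
      (1 + C μ₂ * (y.toSeries * z.toSeries)) * h4 +
      (1 - C μ₁ * z.toSeries - C μ₂ * z.toSeries * (x + y + z).toSeries) * h1 -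
      (1 - C μ₁ * x.toSeries - C μ₂ * x.toSeries * (x + (y + z)).toSeries) * h3
  zero_add x := by
    ext1
    have h := toSeries_add 0 x
    simpa [toSeries_zero] using h
  add_zero x := by
    ext1
    have h := toSeries_add x 0
    simpa [toSeries_zero] using h
  nsmul := nsmulRec
  zsmul := zsmulRec
  neg_add_cancel x := by
    ext1
    refine (isUnit_denom (-x) x).mul_right_cancel ?_
    rw [toSeries_add, toSeries_zero]
    linear_combination toSeries_neg x
  add_comm x y := by
    ext1
    refine (isUnit_denom x y).mul_right_cancel ?_
    rw [toSeries_add, mul_comm x.toSeries, toSeries_add]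
    ring

/-- The linear coefficient is additive for a formal group law. -/
def linearCoeff (μ₁ μ₂ : P) : HyperbolicGroup μ₁ μ₂ →+ P where
  toFun x := coeff 1 x.toSeries
  map_zero' := by simp [toSeries_zero]
  map_add' x y := by
    have h := congrArg (coeff 1) (toSeries_add x y)
    simpa [PowerSeries.coeff_one_mul, constantCoeff_toSeries] using h

/-- The point with power series `c X`. -/
def linear (μ₁ μ₂ c : P) : HyperbolicGroup μ₁ μ₂ := ⟨C c * X, by simp⟩

theorem linearCoeff_linear (c : P) : linearCoeff μ₁ μ₂ (linear μ₁ μ₂ c) = c := by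
  change coeff 1 (C c * X) = c
  simp

/-- Every additive map lifts along the linear coefficient if its source is free. -/
theorem exists_linearCoeff_eq {M : Type*} [AddCommGroup M] [Module.Free ℤ M] (μ₁ μ₂ : P)
    (f : M →+ P) : ∃ ξ : M →+ HyperbolicGroup μ₁ μ₂, ∀ a, linearCoeff μ₁ μ₂ (ξ a) = f a := by
  let b := Module.Free.chooseBasis ℤ M
  let ξ : M →ₗ[ℤ] HyperbolicGroup μ₁ μ₂ := b.constr ℤ fun i => linear μ₁ μ₂ (f (b i))
  have h : (linearCoeff μ₁ μ₂).toIntLinearMap ∘ₗ ξ = f.toIntLinearMap :=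
    b.ext fun i => by simp [ξ, linearCoeff_linear]
  exact ⟨ξ.toAddMonoidHom, fun a => LinearMap.congr_fun h a⟩

end HyperbolicGroup

end HyperbolicGroup

section Specialization

open PowerSeries

variable {R M P : Type*} [CommRing R] [AddCommGroup M] [CommRing P] [Algebra R P] {μ₁ μ₂ : R}
  (ξ : M →+ HyperbolicGroup (algebraMap R P μ₁) (algebraMap R P μ₂)) (N : ℕ)

theorem augIdeal_pow_le_comap :
    augIdeal R M ^ N ≤ (Ideal.span {(X : P⟦X⟧)} ^ N).comap
      (MvPolynomial.aeval (R := R) fun a => (ξ a).toSeries) := by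
  rw [← Ideal.map_le_iff_le_comap, Ideal.map_pow]
  refine Ideal.pow_right_mono ?_ N
  rw [Ideal.map_le_iff_le_comap]
  intro p hp
  have h : (Algebra.ofId R P).comp (MvPolynomial.aeval fun _ : M => (0 : R)) =
      (AlgHom.mk (constantCoeff (R := P)) (fun r => by simp [PowerSeries.algebraMap_apply]) :
        P⟦X⟧ →ₐ[R] P).comp (MvPolynomial.aeval fun a => (ξ a).toSeries) := by
    refine MvPolynomial.algHom_ext fun a => ?_
    simp [HyperbolicGroup.constantCoeff_toSeries]
  have h2 := AlgHom.congr_fun h p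
  rw [augIdeal, RingHom.mem_ker] at hp
  simp only [AlgHom.comp_apply, MvPolynomial.aeval_zero', hp] at h2
  rw [Ideal.mem_comap, Ideal.mem_span_singleton, PowerSeries.X_dvd_iff]
  simpa using h2.symm

/-- The specialization `x_a ↦ ξ_a` of the completion, modulo the `N`-th power of the variable. -/
def complSpecialize : PowerSeriesCompletion R M →ₐ[R] P⟦X⟧ ⧸ Ideal.span {(X : P⟦X⟧)} ^ N :=
  (Ideal.quotientMapₐ _ _ (augIdeal_pow_le_comap ξ N)).comp
    ((AdicCompletion.evalₐ (augIdeal R M) N).restrictScalars R)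

theorem complSpecialize_complX (a : M) :
    complSpecialize ξ N (complX a) = Ideal.Quotient.mk _ (ξ a).toSeries := by
  simp [complSpecialize, complX]

/-- The specialization kills the closure of the ideal, as it factors through the `N`-th step of the
completion. -/
theorem fglIdealClosure_le_ker :
    fglIdealClosure M (hyperbolicFGL μ₁ μ₂) ≤ RingHom.ker (complSpecialize ξ N) := by
  refine (iInf_le _ N).trans (sup_le (Ideal.span_le.2 ?_) ?_)
  · rintro _ (h | ⟨⟨a, b⟩, rfl⟩)
    · rw [Set.mem_singleton_iff] at h
      subst h
      simp [RingHom.mem_ker, complSpecialize_complX, HyperbolicGroup.toSeries_zero]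
    · have hu : IsUnit (Ideal.Quotient.mk (Ideal.span {(X : P⟦X⟧)} ^ N)
          (1 + C (algebraMap R P μ₂) * ((ξ a).toSeries * (ξ b).toSeries))) :=
        (HyperbolicGroup.isUnit_denom (ξ a) (ξ b)).map _
      have halg : ∀ r : R, algebraMap R (P⟦X⟧ ⧸ Ideal.span {(X : P⟦X⟧)} ^ N) r =
          Ideal.Quotient.mk _ (C (algebraMap R P r)) := fun r => by
        rw [IsScalarTower.algebraMap_apply R P⟦X⟧, PowerSeries.algebraMap_apply]; rfl
      have h1 := congrArg (complSpecialize ξ N) (fglEval_hyperbolicFGL_mul μ₁ μ₂ a b)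
      have h2 := congrArg (Ideal.Quotient.mk (Ideal.span {(X : P⟦X⟧)} ^ N))
        (HyperbolicGroup.toSeries_add (ξ a) (ξ b))
      simp only [map_add, map_sub, map_mul, map_one, AlgHom.commutes, complSpecialize_complX,
        halg] at h1 h2 hu
      rw [SetLike.mem_coe, RingHom.mem_ker, map_sub, sub_eq_zero, complSpecialize_complX]
      refine hu.mul_right_cancel ?_
      rw [map_add ξ]
      exact h2.trans h1.symm
  · intro x hx
    rw [RingHom.mem_ker] at hx ⊢
    simp [complSpecialize, hx]

/-- The specialization `x_a ↦ ξ_a` of the formal group algebra, modulo the `N`-th power of the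
variable. -/
def specialize : FormalGroupAlgebra M (hyperbolicFGL μ₁ μ₂) →ₐ[R]
    P⟦X⟧ ⧸ Ideal.span {(X : P⟦X⟧)} ^ N :=
  Ideal.Quotient.liftₐ (fglIdealClosure M (hyperbolicFGL μ₁ μ₂)) (complSpecialize ξ N)
    fun _ hx => fglIdealClosure_le_ker ξ N hx

theorem specialize_xElt (a : M) :
    specialize ξ N (xElt (hyperbolicFGL μ₁ μ₂) a) = Ideal.Quotient.mk _ (ξ a).toSeries :=
  complSpecialize_complX ξ N a

end Specialization

section Regular

variable {R M : Type*} [CommRing R] [AddCommGroup M]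

/-- The additive map from `M` to the symmetric algebra of `R ⊗ M`. -/
def symmetricMap (R M : Type*) [CommRing R] [AddCommGroup M] :
    M →+ SymmetricAlgebra R (TensorProduct ℤ R M) where
  toFun a := SymmetricAlgebra.ι R _ (1 ⊗ₜ a)
  map_zero' := by simp
  map_add' a b := by simp [TensorProduct.tmul_add]

/-- Elements of a basis become regular in the symmetric algebra. -/
theorem symmetricMap_basis_mul_eq_zero {I : Type*} (b : Module.Basis I ℤ M) (i : I)
    {p : SymmetricAlgebra R (TensorProduct ℤ R M)} (hp : symmetricMap R M (b i) * p = 0) :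
    p = 0 := by
  let e := SymmetricAlgebra.equivMvPolynomial (b.baseChange R)
  have h1 : e (symmetricMap R M (b i)) = MvPolynomial.X i := by
    have := SymmetricAlgebra.equivMvPolynomial_ι_apply (b.baseChange R) i
    rwa [Module.Basis.baseChange_apply] at this
  have h2 := congrArg e hp
  rw [map_mul, map_zero, h1] at h2
  exact e.map_eq_zero_iff.1 ((MvPolynomial.isRegular_X (R := R) (n := i)).left
    (h2.trans (mul_zero _).symm))

theorem injective_algebraMap_symmetricAlgebra [Module.Free ℤ M] :
    Function.Injective (algebraMap R (SymmetricAlgebra R (TensorProduct ℤ R M))) := by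
  let e := SymmetricAlgebra.equivMvPolynomial ((Module.Free.chooseBasis ℤ M).baseChange R)
  intro r s hrs
  refine MvPolynomial.C_injective (Module.Free.ChooseBasisIndex ℤ M) R ?_
  have h := congrArg e hrs
  rwa [e.commutes, e.commutes] at h

end Regular

section Injectivity

variable {k h : Type*} [Field k] [AddCommGroup h] [Module k h]
  {l : ℕ} {A : Matrix (Fin l) (Fin l) ℤ} {D : KacMoodyRealization k h A}
  (L : FormalDemazureLattice D) {R : Type*} [CommRing R]

/-- Every real root can be extended to a basis of the lattice, as the Weyl group acts on it. -/
theorem FormalDemazureLattice.exists_basis_realRoot {a : L.carrier}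
    (ha : (a : Module.Dual k h) ∈ D.realRoots) :
    ∃ (n : ℕ) (b : Module.Basis (Fin n) ℤ L.carrier) (m : Fin n), b m = a := by
  obtain ⟨w, i, hw⟩ := ha
  obtain ⟨n, b, m, hb⟩ := L.exists_basis i
  let e : L.carrier ≃+ L.carrier := AddEquiv.mk ⟨L.weylAct w, L.weylAct w⁻¹,
    fun x => by
      change ((L.weylAct w⁻¹).comp (L.weylAct w)) x = x
      rw [← L.weylAct_mul, inv_mul_cancel, L.weylAct_one]; rfl,
    fun x => by
      change ((L.weylAct w).comp (L.weylAct w⁻¹)) x = x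
      rw [← L.weylAct_mul, mul_inv_cancel, L.weylAct_one]; rfl⟩ (L.weylAct w).map_add
  refine ⟨n, b.map e.toIntLinearEquiv, m, ?_⟩
  rw [Module.Basis.map_apply]
  refine Subtype.ext ?_
  change w.1 (b m).1 = a.1
  rw [hb, hw]

open PowerSeries in
/-- The elements of `R` are not killed by products of the `x_a` for real roots `a`. -/
theorem injective_algebraMap_QF (μ₁ μ₂ : R) :
    Function.Injective (algebraMap R (QF L (hyperbolicFGL μ₁ μ₂))) := by
  have := L.free
  let P := SymmetricAlgebra R (TensorProduct ℤ R L.carrier)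
  obtain ⟨ξ, hξ⟩ := HyperbolicGroup.exists_linearCoeff_eq (algebraMap R P μ₁) (algebraMap R P μ₂)
    (symmetricMap R L.carrier)
  -- an element of the root submonoid specializes to a series with regular leading coefficient
  have key : ∀ y ∈ rootSubmonoid L (hyperbolicFGL μ₁ μ₂), ∃ (d : ℕ) (g : P⟦X⟧),
      (∀ N, specialize ξ N y = Ideal.Quotient.mk _ (X ^ d * g)) ∧
        ∀ p, constantCoeff g * p = 0 → p = 0 := by
    intro y hy
    induction hy using Submonoid.closure_induction with
    | mem y hy =>
      obtain ⟨a, ha, rfl⟩ := hy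
      obtain ⟨g, hg⟩ := PowerSeries.X_dvd_iff.2 (ξ a).constantCoeff_toSeries
      refine ⟨1, g, fun N => by rw [specialize_xElt, hg, pow_one], fun p hp => ?_⟩
      obtain ⟨n, b, m, rfl⟩ := L.exists_basis_realRoot ha
      refine symmetricMap_basis_mul_eq_zero b m ?_
      rw [← hξ]
      change coeff 1 (ξ (b m)).toSeries * p = 0
      rw [hg, ← zero_add 1, coeff_succ_X_mul, coeff_zero_eq_constantCoeff_apply, hp]
    | one => exact ⟨0, 1, fun N => by simp, fun p hp => by simpa using hp⟩
    | mul x y _ _ hx hy =>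
      obtain ⟨d, g, h1, h2⟩ := hx
      obtain ⟨d', g', h1', h2'⟩ := hy
      refine ⟨d + d', g * g', fun N => ?_, fun p hp => ?_⟩
      · rw [map_mul, h1, h1', ← map_mul]
        congr 1
        ring
      · rw [map_mul, mul_assoc] at hp
        exact h2' _ (h2 _ hp)
  rw [injective_iff_map_eq_zero]
  intro r hr
  rw [IsScalarTower.algebraMap_apply R (FormalGroupAlgebra L.carrier (hyperbolicFGL μ₁ μ₂)),
    IsLocalization.map_eq_zero_iff (rootSubmonoid L (hyperbolicFGL μ₁ μ₂))] at hr
  obtain ⟨⟨y, hy⟩, hr⟩ := hr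
  obtain ⟨d, g, h1, h2⟩ := key y hy
  have h3 := congrArg (specialize ξ (d + 1)) hr
  have halg : algebraMap R (P⟦X⟧ ⧸ Ideal.span {(X : P⟦X⟧)} ^ (d + 1)) r =
      Ideal.Quotient.mk _ (C (algebraMap R P r)) := by
    rw [IsScalarTower.algebraMap_apply R P⟦X⟧, PowerSeries.algebraMap_apply]; rfl
  rw [map_mul, map_zero, AlgHom.commutes, h1, halg, ← map_mul, Ideal.Quotient.eq_zero_iff_mem,
    Ideal.span_singleton_pow, Ideal.mem_span_singleton, PowerSeries.X_pow_dvd_iff] at h3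
  have h4 := h3 d (Nat.lt_succ_self d)
  rw [mul_assoc, coeff_X_pow_mul', if_pos le_rfl, Nat.sub_self] at h4
  refine injective_algebraMap_symmetricAlgebra (M := L.carrier) ?_
  rw [map_zero]
  exact h2 _ (by simpa using h4)

end Injectivity

/-! ### Braid relations between Demazure elements -/

section Braid

variable {k h : Type*} [Field k] [AddCommGroup h] [Module k h]
  {l : ℕ} {A : Matrix (Fin l) (Fin l) ℤ} {D : KacMoodyRealization k h A}
  (L : FormalDemazureLattice D) {R : Type*} [CommRing R] (F : MvPowerSeries (Fin 2) R)

/-- The inclusion of the coefficient ring `Q^F` into `Q^F_W`. -/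
def coeffHom : QF L F →ₐ[R] TwistedAlgebra L F where
  toFun q := SkewMonoidAlgebra.single 1 q
  map_one' := rfl
  map_mul' q q' := by
    rw [SkewMonoidAlgebra.single_mul_single, one_smul, one_mul]
  map_zero' := by simp
  map_add' q q' := by simp
  commutes' r := rfl

/-- The element `δ_{s_i}` of `Q^F_W`. -/
def deltaRefl (i : Fin l) : TwistedAlgebra L F := SkewMonoidAlgebra.single (D.simpleRefl i) 1

theorem deltaRefl_mul_self (i : Fin l) : deltaRefl L F i * deltaRefl L F i = 1 := by
  rw [deltaRefl, SkewMonoidAlgebra.single_mul_single, smul_one, one_mul, D.simpleRefl_mul_self]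
  rfl

theorem deltaRefl_mul_coeffHom (i : Fin l) (q : QF L F) :
    deltaRefl L F i * coeffHom L F q =
      coeffHom L F (weylQFHom F (D.simpleRefl i) q) * deltaRefl L F i := by
  change SkewMonoidAlgebra.single _ _ * SkewMonoidAlgebra.single _ _ =
    SkewMonoidAlgebra.single _ _ * SkewMonoidAlgebra.single _ _
  rw [SkewMonoidAlgebra.single_mul_single, SkewMonoidAlgebra.single_mul_single, smul_one, one_mul,
    mul_one, mul_one, one_mul, weylQFHom_apply]

theorem altProd_deltaRefl (n : ℕ) (i j : Fin l) :
    altProd n (deltaRefl L F i) (deltaRefl L F j) =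
      SkewMonoidAlgebra.single (altProd n (D.simpleRefl i) (D.simpleRefl j)) 1 := by
  induction n generalizing i j with
  | zero => rfl
  | succ n ih =>
    rw [altProd_succ, ih, altProd_succ, deltaRefl, SkewMonoidAlgebra.single_mul_single, smul_one,
      one_mul]

theorem demazureElement_eq (i : Fin l) :
    demazureElement L F i =
      coeffHom L F (invRoot L F (L.simpleRoot i)) * (1 - deltaRefl L F i) := by
  rw [invRoot_simpleRoot]
  rfl

variable {L}

theorem simpleRoot_mem_realRoots (i : Fin l) :
    (L.simpleRoot i : Module.Dual k h) ∈ D.realRoots := ⟨1, i, rfl⟩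

theorem weylAct_simpleRoot_self (i : Fin l) :
    L.weylAct (D.simpleRefl i) (L.simpleRoot i) = -L.simpleRoot i :=
  Subtype.ext (D.simpleRefl_root_self i)

theorem weylAct_simpleRoot (i j : Fin l) :
    L.weylAct (D.simpleRefl i) (L.simpleRoot j) = L.simpleRoot j - A i j • L.simpleRoot i := by
  exact Subtype.ext ((D.simpleRefl_root i j).trans
    (congrArg (D.root j - ·) (Int.cast_smul_eq_zsmul k (A i j) (D.root i))))

variable (L)

theorem demazureElement_mul_self (μ₁ μ₂ : R) (i : Fin l) :
    demazureElement L (hyperbolicFGL μ₁ μ₂) i * demazureElement L (hyperbolicFGL μ₁ μ₂) i =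
      μ₁ • demazureElement L (hyperbolicFGL μ₁ μ₂) i := by
  have ha := simpleRoot_mem_realRoots (L := L) i
  have hna := weylAct_mem_realRoots (D.simpleRefl i) ha
  have h1 := weylQFHom_invRoot (hyperbolicFGL μ₁ μ₂) (D.simpleRefl i) ha
  rw [weylAct_simpleRoot_self] at hna h1
  rw [invRoot_neg μ₁ μ₂ ha hna] at h1
  have h2 := deltaRefl_mul_coeffHom L (hyperbolicFGL μ₁ μ₂) i
    (invRoot L (hyperbolicFGL μ₁ μ₂) (L.simpleRoot i))
  have h3 := deltaRefl_mul_self L (hyperbolicFGL μ₁ μ₂) i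
  rw [h1, map_sub, AlgHom.commutes] at h2
  rw [demazureElement_eq, Algebra.smul_def]
  have h4 := Algebra.commutes μ₁ (coeffHom L (hyperbolicFGL μ₁ μ₂)
    (invRoot L (hyperbolicFGL μ₁ μ₂) (L.simpleRoot i)))
  generalize coeffHom L (hyperbolicFGL μ₁ μ₂)
    (invRoot L (hyperbolicFGL μ₁ μ₂) (L.simpleRoot i)) = p at *
  generalize deltaRefl L (hyperbolicFGL μ₁ μ₂) i = d at *
  generalize algebraMap R (TwistedAlgebra L (hyperbolicFGL μ₁ μ₂)) μ₁ = m at *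
  calc p * (1 - d) * (p * (1 - d)) = p * (p - d * p) * (1 - d) := by noncomm_ring
    _ = p * m * (1 - d) + p * (p - m) * (1 + d) * (1 - d) := by rw [h2]; noncomm_ring
    _ = m * (p * (1 - d)) + p * (p - m) * (1 - d * d) := by rw [← h4]; noncomm_ring
    _ = m * (p * (1 - d)) := by rw [h3, sub_self, mul_zero, add_zero]

variable {L}

theorem weylQFHom_invRoot_eq (i : Fin l) {a b : L.carrier}
    (ha : (a : Module.Dual k h) ∈ D.realRoots) (hab : L.weylAct (D.simpleRefl i) a = b) :
    weylQFHom F (D.simpleRefl i) (invRoot L F a) = invRoot L F b := by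
  rw [weylQFHom_invRoot F _ ha, hab]

theorem weylQFHom_invRoot_self (μ₁ μ₂ : R) (i : Fin l) :
    weylQFHom (hyperbolicFGL μ₁ μ₂) (D.simpleRefl i)
        (invRoot L (hyperbolicFGL μ₁ μ₂) (L.simpleRoot i)) =
      algebraMap R _ μ₁ - invRoot L (hyperbolicFGL μ₁ μ₂) (L.simpleRoot i) := by
  have ha := simpleRoot_mem_realRoots (L := L) i
  have hna := weylAct_mem_realRoots (D.simpleRefl i) ha
  rw [weylQFHom_invRoot _ _ ha]
  rw [weylAct_simpleRoot_self] at hna ⊢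
  exact invRoot_neg μ₁ μ₂ ha hna

theorem mem_realRoots_of_weylAct_eq (i : Fin l) {a b : L.carrier}
    (ha : (a : Module.Dual k h) ∈ D.realRoots) (hab : L.weylAct (D.simpleRefl i) a = b) :
    (b : Module.Dual k h) ∈ D.realRoots := hab ▸ weylAct_mem_realRoots _ ha

variable (L)

/-- The symmetry of `klProd` in two Demazure elements, for each type of rank two. The roots of the
subsystem are listed in the convex order from `α = α_i` to `β = α_j`. -/
theorem klProd_demazureElement_comm_of_finiteType (μ₁ μ₂ : R) {i j : Fin l} {a b : ℤ} {m : ℕ}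
    (hm : KacMoodyRealization.FiniteType a b m) (hij : A i j = a) (hji : A j i = b)
    (hb : altProd m (D.simpleRefl i) (D.simpleRefl j) =
      altProd m (D.simpleRefl j) (D.simpleRefl i)) :
    klProd μ₂ m (demazureElement L (hyperbolicFGL μ₁ μ₂) i)
        (demazureElement L (hyperbolicFGL μ₁ μ₂) j) =
      klProd μ₂ m (demazureElement L (hyperbolicFGL μ₁ μ₂) j)
        (demazureElement L (hyperbolicFGL μ₁ μ₂) i) := by
  have hb' : altProd m (deltaRefl L (hyperbolicFGL μ₁ μ₂) i)
      (deltaRefl L (hyperbolicFGL μ₁ μ₂) j) =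
        altProd m (deltaRefl L (hyperbolicFGL μ₁ μ₂) j) (deltaRefl L (hyperbolicFGL μ₁ μ₂) i) := by
    rw [altProd_deltaRefl, altProd_deltaRefl, hb]
  wlog hab : a ≤ b generalizing a b i j
  · refine (this (a := b) (b := a) ?_ hji hij hb.symm hb'.symm (le_of_not_ge hab)).symm
    cases hm <;> constructor
  simp only [demazureElement_eq]
  have hi := weylAct_simpleRoot_self (L := L) i
  have hj := weylAct_simpleRoot_self (L := L) j
  have hsi := weylAct_simpleRoot (L := L) i j
  have hsj := weylAct_simpleRoot (L := L) j i
  rw [hij] at hsi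
  rw [hji] at hsj
  have ri := simpleRoot_mem_realRoots (L := L) i
  have rj := simpleRoot_mem_realRoots (L := L) j
  have hd := deltaRefl_mul_self L (hyperbolicFGL μ₁ μ₂)
  have hσ := deltaRefl_mul_coeffHom L (hyperbolicFGL μ₁ μ₂)
  have ei := weylQFHom_invRoot_self (L := L) μ₁ μ₂ i
  have ej := weylQFHom_invRoot_self (L := L) μ₁ μ₂ j
  clear hij hji
  generalize L.simpleRoot i = α at *
  generalize L.simpleRoot j = β at *
  cases hm with
  | a1a1 =>
    -- `α, β`
    exact klProd_demazure_comm_two (hd i) (hd j) (hσ i) (hσ j) hb' μ₂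
      (weylQFHom_invRoot_eq _ i rj (by rw [hsi, zero_smul, sub_zero]))
      (weylQFHom_invRoot_eq _ j ri (by rw [hsj, zero_smul, sub_zero]))
  | a2 =>
    -- `α, α + β, β`
    have e2 : L.weylAct (D.simpleRefl i) β = α + β := by rw [hsi]; abel
    have e2' : L.weylAct (D.simpleRefl j) α = α + β := by rw [hsj]; abel
    have r2 := mem_realRoots_of_weylAct_eq i rj e2
    exact klProd_demazure_comm_three (hd i) (hd j) (hσ i) (hσ j) hb' ei ej
      (weylQFHom_invRoot_eq _ i r2 (by rw [map_add, hi, hsi]; abel))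
      (weylQFHom_invRoot_eq _ i rj e2)
      (weylQFHom_invRoot_eq _ j ri e2')
      (weylQFHom_invRoot_eq _ j r2 (by rw [map_add, hj, hsj]; abel))
      (invRoot_add μ₁ μ₂ ri rj r2 rfl)
  | c2 =>
    -- `α, 2 α + β, α + β, β`
    have e4 : L.weylAct (D.simpleRefl i) β = 2 • α + β := by rw [hsi]; abel
    have e1 : L.weylAct (D.simpleRefl j) α = α + β := by rw [hsj]; abel
    have r2 := mem_realRoots_of_weylAct_eq i rj e4
    have r3 := mem_realRoots_of_weylAct_eq j ri e1
    exact klProd_demazure_comm_four (hd i) (hd j) (hσ i) (hσ j) hb' ei ej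
      (weylQFHom_invRoot_eq _ i r2 (by rw [map_add, map_nsmul, hi, hsi]; abel))
      (weylQFHom_invRoot_eq _ i r3 (by rw [map_add, hi, hsi]; abel))
      (weylQFHom_invRoot_eq _ i rj e4)
      (weylQFHom_invRoot_eq _ j ri e1)
      (weylQFHom_invRoot_eq _ j r2 (by rw [map_add, map_nsmul, hj, hsj]; abel))
      (weylQFHom_invRoot_eq _ j r3 (by rw [map_add, hj, hsj]; abel))
      (invRoot_add μ₁ μ₂ ri r3 r2 (by abel))
      (invRoot_add μ₁ μ₂ ri rj r3 (by abel))
  | g2' =>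
    -- `α, 3 α + β, 2 α + β, 3 α + 2 β, α + β, β`
    have e6 : L.weylAct (D.simpleRefl i) β = 3 • α + β := by rw [hsi]; abel
    have e1 : L.weylAct (D.simpleRefl j) α = α + β := by rw [hsj]; abel
    have r2 := mem_realRoots_of_weylAct_eq i rj e6
    have r5 := mem_realRoots_of_weylAct_eq j ri e1
    have e5 : L.weylAct (D.simpleRefl i) (α + β) = 2 • α + β := by rw [map_add, hi, hsi]; abel
    have r3 := mem_realRoots_of_weylAct_eq i r5 e5
    have e2 : L.weylAct (D.simpleRefl j) (3 • α + β) = 3 • α + 2 • β := by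
      rw [map_add, map_nsmul, hj, hsj]; abel
    have r4 := mem_realRoots_of_weylAct_eq j r2 e2
    exact klProd_demazure_comm_six (hd i) (hd j) (hσ i) (hσ j) hb' ei ej
      (weylQFHom_invRoot_eq _ i r2 (by rw [map_add, map_nsmul, hi, hsi]; abel))
      (weylQFHom_invRoot_eq _ i r3 (by rw [map_add, map_nsmul, hi, hsi]; abel))
      (weylQFHom_invRoot_eq _ i r4 (by rw [map_add, map_nsmul, map_nsmul, hi, hsi]; abel))
      (weylQFHom_invRoot_eq _ i r5 e5)
      (weylQFHom_invRoot_eq _ i rj e6)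
      (weylQFHom_invRoot_eq _ j ri e1)
      (weylQFHom_invRoot_eq _ j r2 e2)
      (weylQFHom_invRoot_eq _ j r3 (by rw [map_add, map_nsmul, hj, hsj]; abel))
      (weylQFHom_invRoot_eq _ j r4 (by rw [map_add, map_nsmul, map_nsmul, hj, hsj]; abel))
      (weylQFHom_invRoot_eq _ j r5 (by rw [map_add, hj, hsj]; abel))
      (invRoot_add μ₁ μ₂ ri r5 r3 (by abel))
      (invRoot_add μ₁ μ₂ r2 rj r4 (by abel))
      (invRoot_add μ₁ μ₂ ri r3 r2 (by abel))
      (invRoot_add μ₁ μ₂ r3 r5 r4 (by abel))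
      (invRoot_add μ₁ μ₂ ri rj r5 rfl)
  | b2 => omega
  | g2 => omega

theorem klProd_demazureElement_comm [CharZero k] (μ₁ μ₂ : R) {i j : Fin l} (hij : i ≠ j)
    (hm : orderOf (D.simpleRefl i * D.simpleRefl j) ≠ 0) :
    klProd μ₂ (orderOf (D.simpleRefl i * D.simpleRefl j))
        (demazureElement L (hyperbolicFGL μ₁ μ₂) i) (demazureElement L (hyperbolicFGL μ₁ μ₂) j) =
      klProd μ₂ (orderOf (D.simpleRefl i * D.simpleRefl j))
        (demazureElement L (hyperbolicFGL μ₁ μ₂) j)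
        (demazureElement L (hyperbolicFGL μ₁ μ₂) i) := by
  have hb := D.altProd_comm_simpleRefl i j
  rcases KacMoodyRealization.finiteType_or_four_le D.gcm hij with ⟨m, hft⟩ | h4
  · rw [hft.orderOf_eq D hij] at hb ⊢
    exact klProd_demazureElement_comm_of_finiteType L μ₁ μ₂ hft rfl rfl hb
  · exact absurd (D.orderOf_eq_zero_of_four_le hij h4) hm

end Braid

/-! ### Comparison with the Hecke algebra -/

section HeckeRelations

variable {k h : Type*} [Field k] [AddCommGroup h] [Module k h]
  {l : ℕ} {A : Matrix (Fin l) (Fin l) ℤ} (D : KacMoodyRealization k h A)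
  (R : Type*) [CommRing R] [Algebra (LaurentPolynomial ℤ) R]

theorem tElt_mul_tInv : tElt R * tInv R = 1 := by
  rw [tElt, tInv, ← map_mul, ← LaurentPolynomial.T_add, add_neg_cancel, LaurentPolynomial.T_zero,
    map_one]

theorem quadratic_iff {B : Type*} [Ring B] [Algebra R B] (T : B) :
    (T + algebraMap R B (tElt R)) * (T - algebraMap R B (tInv R)) = 0 ↔
      T * T = (tInv R - tElt R) • T + 1 := by
  have h1 : algebraMap R B (tElt R) * algebraMap R B (tInv R) = 1 := by
    rw [← map_mul, tElt_mul_tInv, map_one]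
  have h2 : (T + algebraMap R B (tElt R)) * (T - algebraMap R B (tInv R)) =
      T * T - ((tInv R - tElt R) • T + 1) := by
    rw [add_mul, mul_sub, mul_sub, h1, Algebra.smul_def, map_sub, sub_mul,
      Algebra.commutes (tInv R) T]
    abel
  rw [h2, sub_eq_zero]

theorem smul_add_scalar_mul_self {B : Type*} [Ring B] [Algebra R B] (u : R) {T : B}
    (hT : T * T = (tInv R - tElt R) • T + 1) :
    u • (T + tElt R • (1 : B)) * u • (T + tElt R • (1 : B)) =
      (u * (tElt R + tInv R)) • u • (T + tElt R • (1 : B)) := by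
  rw [smul_mul_smul_comm, add_mul, mul_add, mul_add, hT, smul_mul_assoc, one_mul, mul_smul_comm,
    mul_one, smul_mul_assoc, one_mul]
  match_scalars
  · ring
  · linear_combination (-u * u) * tElt_mul_tInv R

/-- In the generators `T + t`, the braid relations become symmetries of `klProd`. -/
theorem klProd_comm_iff_altProd_comm {B : Type*} [Ring B] [Algebra R B] {a b : B}
    (ha : a * a = (tInv R - tElt R) • a + 1) (hb : b * b = (tInv R - tElt R) • b + 1) {m : ℕ}
    (hm : m ≠ 0) :
    klProd (-1 : R) m (a + tElt R • 1) (b + tElt R • 1) =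
        klProd (-1 : R) m (b + tElt R • 1) (a + tElt R • 1) ↔
      altProd m a b = altProd m b a := by
  obtain ⟨m, rfl⟩ := Nat.exists_eq_succ_of_ne_zero hm
  rw [Nat.succ_eq_add_one, klProd_add_scalar (tElt_mul_tInv R) m ha hb,
    klProd_add_scalar (tElt_mul_tInv R) m hb ha, heckeTail_comm, add_left_inj]

theorem heckeT_quadratic (i : Fin l) :
    heckeT D R i * heckeT D R i = (tInv R - tElt R) • heckeT D R i + 1 := by
  rw [← quadratic_iff]
  have h1 := RingQuot.mkAlgHom_rel R (HeckeRel.quadratic (D := D) (R := R) i)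
  rw [map_mul, map_add, map_sub, map_zero, AlgHom.commutes, AlgHom.commutes] at h1
  exact h1

theorem altProd_map {B C : Type*} [Monoid B] [Monoid C] (f : B →* C) (n : ℕ) (a b : B) :
    f (altProd n a b) = altProd n (f a) (f b) := by
  induction n generalizing a b with
  | zero => exact map_one f
  | succ n ih => rw [altProd_succ, map_mul, ih, altProd_succ]

theorem heckeT_braid {i j : Fin l} (hij : i ≠ j)
    (hm : orderOf (D.simpleRefl i * D.simpleRefl j) ≠ 0) :
    altProd (orderOf (D.simpleRefl i * D.simpleRefl j)) (heckeT D R i) (heckeT D R j) =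
      altProd (orderOf (D.simpleRefl i * D.simpleRefl j)) (heckeT D R j) (heckeT D R i) := by
  have h1 := RingQuot.mkAlgHom_rel R (HeckeRel.braid (D := D) (R := R) i j hij hm)
  rwa [← AlgHom.coe_toMonoidHom, altProd_map, altProd_map] at h1

theorem adjoin_range_heckeT : Algebra.adjoin R (Set.range (heckeT D R)) = ⊤ := by
  have h1 : Set.range (heckeT D R) =
      RingQuot.mkAlgHom R (HeckeRel D R) '' Set.range (FreeAlgebra.ι R) := by
    rw [← Set.range_comp]; rfl
  rw [h1, ← AlgHom.map_adjoin, FreeAlgebra.adjoin_range_ι, Algebra.map_top]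
  exact (AlgHom.range_eq_top _).2 (RingQuot.mkAlgHom_surjective R _)

variable {R}

/-- The element `u (T_i + t)` of the Hecke algebra. -/
def heckeDemazure (u : R) (i : Fin l) : HeckeAlgebra D R :=
  u • (heckeT D R i + algebraMap R (HeckeAlgebra D R) (tElt R))

theorem heckeDemazure_mul_self (u : R) (i : Fin l) :
    heckeDemazure D u i * heckeDemazure D u i = (u * (tElt R + tInv R)) • heckeDemazure D u i := by
  rw [heckeDemazure, Algebra.algebraMap_eq_smul_one]
  exact smul_add_scalar_mul_self R u (heckeT_quadratic D R i)

theorem klProd_heckeDemazure_comm (u : R) {i j : Fin l} (hij : i ≠ j)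
    (hm : orderOf (D.simpleRefl i * D.simpleRefl j) ≠ 0) :
    klProd (-u ^ 2) (orderOf (D.simpleRefl i * D.simpleRefl j))
        (heckeDemazure D u i) (heckeDemazure D u j) =
      klProd (-u ^ 2) (orderOf (D.simpleRefl i * D.simpleRefl j))
        (heckeDemazure D u j) (heckeDemazure D u i) := by
  rw [heckeDemazure, heckeDemazure, Algebra.algebraMap_eq_smul_one,
    show -u ^ 2 = u ^ 2 * (-1) by ring, klProd_smul, klProd_smul,
    (klProd_comm_iff_altProd_comm R (heckeT_quadratic D R i) (heckeT_quadratic D R j) hm).2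
      (heckeT_braid D R hij hm)]

/-- The universal property of the Hecke algebra. -/
theorem exists_heckeAlgHom {B : Type*} [Ring B] [Algebra R B] (T : Fin l → B)
    (hsq : ∀ i, T i * T i = (tInv R - tElt R) • T i + 1)
    (hbr : ∀ i j, i ≠ j → orderOf (D.simpleRefl i * D.simpleRefl j) ≠ 0 →
      altProd (orderOf (D.simpleRefl i * D.simpleRefl j)) (T i) (T j) =
        altProd (orderOf (D.simpleRefl i * D.simpleRefl j)) (T j) (T i)) :
    ∃ χ : HeckeAlgebra D R →ₐ[R] B, ∀ i, χ (heckeT D R i) = T i := by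
  refine ⟨RingQuot.liftAlgHom R ⟨FreeAlgebra.lift R T, ?_⟩, fun i => ?_⟩
  · intro x y hxy
    cases hxy with
    | quadratic i =>
      rw [map_mul, map_add, map_sub, AlgHom.commutes, AlgHom.commutes, map_zero,
        FreeAlgebra.lift_ι_apply, quadratic_iff]
      exact hsq i
    | braid i j hij hm =>
      rw [← AlgHom.coe_toMonoidHom, altProd_map, altProd_map, AlgHom.coe_toMonoidHom,
        FreeAlgebra.lift_ι_apply, FreeAlgebra.lift_ι_apply]
      exact hbr i j hij hm
  · rw [heckeT, RingQuot.liftAlgHom_mkAlgHom_apply, FreeAlgebra.lift_ι_apply]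

end HeckeRelations

section Comparison

variable {k h : Type*} [Field k] [CharZero k] [AddCommGroup h] [Module k h]
  {l : ℕ} {A : Matrix (Fin l) (Fin l) ℤ} {D : KacMoodyRealization k h A}
  (L : FormalDemazureLattice D) {R : Type*} [CommRing R] [Algebra (LaurentPolynomial ℤ) R]
  {u μ₁ μ₂ : R}

/-- The pair of the Demazure element `X_i` and its intended image `u (T_i + t)`. -/
def demazurePair (u μ₁ μ₂ : R) (i : Fin l) :
    TwistedAlgebra L (hyperbolicFGL μ₁ μ₂) × HeckeAlgebra D R :=
  (demazureElement L (hyperbolicFGL μ₁ μ₂) i, heckeDemazure D u i)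

theorem quasiBraid_demazurePair (hμ₁ : μ₁ = u * (tElt R + tInv R)) (hμ₂ : μ₂ = -u ^ 2) :
    D.QuasiBraid μ₁ (demazurePair L u μ₁ μ₂) where
  sq i := Prod.ext (demazureElement_mul_self L μ₁ μ₂ i) (by
    subst hμ₁
    exact heckeDemazure_mul_self D u i)
  braid i j hij hm := by
    refine altProd_sub_altProd_mem (demazurePair L u μ₁ μ₂) μ₂ hm (Prod.ext ?_ ?_)
    · have h1 := klProd_map (AlgHom.fst R (TwistedAlgebra L (hyperbolicFGL μ₁ μ₂))
        (HeckeAlgebra D R)) μ₂ (orderOf (D.simpleRefl i * D.simpleRefl j))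
      exact (h1 (demazurePair L u μ₁ μ₂ i) (demazurePair L u μ₁ μ₂ j)).trans
        ((klProd_demazureElement_comm L μ₁ μ₂ hij hm).trans
          (h1 (demazurePair L u μ₁ μ₂ j) (demazurePair L u μ₁ μ₂ i)).symm)
    · have h1 := klProd_map (AlgHom.snd R (TwistedAlgebra L (hyperbolicFGL μ₁ μ₂))
        (HeckeAlgebra D R)) μ₂ (orderOf (D.simpleRefl i * D.simpleRefl j))
      refine (h1 (demazurePair L u μ₁ μ₂ i) (demazurePair L u μ₁ μ₂ j)).trans
        (Eq.trans ?_ (h1 (demazurePair L u μ₁ μ₂ j) (demazurePair L u μ₁ μ₂ i)).symm)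
      subst hμ₂
      exact klProd_heckeDemazure_comm D u hij hm

/-- The graph of the comparison map: the subalgebra generated by the pairs `(X_i, u (T_i + t))`. -/
def demazureGraph (u μ₁ μ₂ : R) :
    Subalgebra R (TwistedAlgebra L (hyperbolicFGL μ₁ μ₂) × HeckeAlgebra D R) :=
  Algebra.adjoin R (Set.range (demazurePair L u μ₁ μ₂))

theorem eq_zero_of_mem_demazureGraph (hμ₁ : μ₁ = u * (tElt R + tInv R)) (hμ₂ : μ₂ = -u ^ 2)
    {x : TwistedAlgebra L (hyperbolicFGL μ₁ μ₂) × HeckeAlgebra D R}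
    (hx : x ∈ demazureGraph L u μ₁ μ₂) (hx1 : x.1 = 0) : x = 0 := by
  have h1 := (quasiBraid_demazurePair L hμ₁ hμ₂).adjoin_le_span hx
  obtain ⟨c, rfl⟩ := Finsupp.mem_span_range_iff_exists_finsupp.1 h1
  have h3 : c = 0 := by
    refine linearIndependent_iff.1 (linearIndependent_demazure L (hyperbolicFGL μ₁ μ₂)
      (injective_algebraMap_QF L μ₁ μ₂)) c ?_
    rw [← hx1]
    change _ = AlgHom.fst R (TwistedAlgebra L (hyperbolicFGL μ₁ μ₂)) (HeckeAlgebra D R) _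
    rw [map_finsuppSum, Finsupp.linearCombination_apply]
    refine Finsupp.sum_congr fun w _ => ?_
    rw [map_smul, map_list_prod, List.map_map]
    rfl
  rw [h3, Finsupp.sum_zero_index]

/-- The first projection identifies the graph with the formal Demazure algebra. -/
theorem exists_demazureGraph_equiv (hμ₁ : μ₁ = u * (tElt R + tInv R)) (hμ₂ : μ₂ = -u ^ 2) :
    ∃ e : demazureGraph L u μ₁ μ₂ ≃ₐ[R] formalDemazureAlgebra L (hyperbolicFGL μ₁ μ₂),
      ∀ x, (e x : TwistedAlgebra L (hyperbolicFGL μ₁ μ₂)) = x.1.1 := by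
  let f := AlgHom.fst R (TwistedAlgebra L (hyperbolicFGL μ₁ μ₂)) (HeckeAlgebra D R)
  have hmap : (demazureGraph L u μ₁ μ₂).map f = formalDemazureAlgebra L (hyperbolicFGL μ₁ μ₂) := by
    rw [demazureGraph, AlgHom.map_adjoin, ← Set.range_comp]
    rfl
  have hmem : ∀ x : demazureGraph L u μ₁ μ₂,
      f x.1 ∈ formalDemazureAlgebra L (hyperbolicFGL μ₁ μ₂) := fun x =>
    hmap ▸ Subalgebra.mem_map.2 ⟨x.1, x.2, rfl⟩
  let g := (f.comp (demazureGraph L u μ₁ μ₂).val).codRestrict _ hmem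
  have hg : Function.Bijective g := by
    constructor
    · rw [injective_iff_map_eq_zero]
      intro x hx
      exact Subtype.ext (eq_zero_of_mem_demazureGraph L hμ₁ hμ₂ x.2 (congrArg Subtype.val hx))
    · rintro ⟨y, hy⟩
      rw [← hmap] at hy
      obtain ⟨x, hx, rfl⟩ := hy
      exact ⟨⟨x, hx⟩, rfl⟩
  exact ⟨AlgEquiv.ofBijective g hg, fun _ => rfl⟩

theorem exists_demazureToHecke (hμ₁ : μ₁ = u * (tElt R + tInv R)) (hμ₂ : μ₂ = -u ^ 2) :
    ∃ ψ : formalDemazureAlgebra L (hyperbolicFGL μ₁ μ₂) →ₐ[R] HeckeAlgebra D R,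
      ∀ i, ψ (demazureGen L (hyperbolicFGL μ₁ μ₂) i) = heckeDemazure D u i := by
  obtain ⟨e, he⟩ := exists_demazureGraph_equiv L hμ₁ hμ₂
  refine ⟨((AlgHom.snd R (TwistedAlgebra L (hyperbolicFGL μ₁ μ₂)) (HeckeAlgebra D R)).comp
    (demazureGraph L u μ₁ μ₂).val).comp e.symm.toAlgHom, fun i => ?_⟩
  let x : demazureGraph L u μ₁ μ₂ := ⟨demazurePair L u μ₁ μ₂ i, Algebra.subset_adjoin ⟨i, rfl⟩⟩
  have h1 : e.symm (demazureGen L (hyperbolicFGL μ₁ μ₂) i) = x := by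
    rw [AlgEquiv.symm_apply_eq]
    exact Subtype.ext (he x).symm
  change (e.symm (demazureGen L (hyperbolicFGL μ₁ μ₂) i)).1.2 = _
  rw [h1]
  rfl

omit [CharZero k] [Algebra (LaurentPolynomial ℤ) R] in
theorem demazureAlgHom_ext {F : MvPowerSeries (Fin 2) R} {B : Type*} [Ring B] [Algebra R B]
    {φ ψ : formalDemazureAlgebra L F →ₐ[R] B}
    (h : ∀ i, φ (demazureGen L F i) = ψ (demazureGen L F i)) : φ = ψ := by
  refine AlgHom.adjoin_ext ?_
  rintro _ ⟨i, rfl⟩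
  exact h i

/-- For invertible `u`, the elements `u⁻¹ X_i - t` satisfy the relations of the Hecke algebra. -/
theorem exists_heckeToTwisted (hμ₁ : μ₁ = u * (tElt R + tInv R)) (hμ₂ : μ₂ = -u ^ 2)
    {v : R} (huv : v * u = 1) :
    ∃ χ : HeckeAlgebra D R →ₐ[R] TwistedAlgebra L (hyperbolicFGL μ₁ μ₂),
      ∀ i, χ (heckeT D R i) =
        v • demazureElement L (hyperbolicFGL μ₁ μ₂) i - tElt R • (1 : TwistedAlgebra L _) := by
  have hX := demazureElement_mul_self L μ₁ μ₂
  have hbr := fun i j => klProd_demazureElement_comm L (i := i) (j := j) μ₁ μ₂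
  generalize demazureElement L (hyperbolicFGL μ₁ μ₂) = x at hX hbr ⊢
  have hsq : ∀ i, (v • x i - tElt R • 1) * (v • x i - tElt R • 1) =
      (tInv R - tElt R) • (v • x i - tElt R • 1) + 1 := by
    intro i
    simp only [sub_mul, mul_sub, smul_mul_smul_comm, hX, mul_one, one_mul]
    match_scalars
    · subst hμ₁
      linear_combination v * (tElt R + tInv R) * huv
    · linear_combination tElt_mul_tInv R
  refine exists_heckeAlgHom D _ hsq fun i j hij hm => ?_
  have h2 : v ^ 2 * μ₂ = -1 := by
    subst hμ₂
    linear_combination (-(v * u) - 1) * huv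
  rw [← klProd_comm_iff_altProd_comm R (hsq i) (hsq j) hm, sub_add_cancel, sub_add_cancel, ← h2,
    klProd_smul, klProd_smul, hbr i j hij hm]

theorem bijective_demazureToHecke (hμ₁ : μ₁ = u * (tElt R + tInv R)) (hμ₂ : μ₂ = -u ^ 2)
    (hu : IsUnit u) (ψ : formalDemazureAlgebra L (hyperbolicFGL μ₁ μ₂) →ₐ[R] HeckeAlgebra D R)
    (hψ : ∀ i, ψ (demazureGen L (hyperbolicFGL μ₁ μ₂) i) = heckeDemazure D u i) :
    Function.Bijective ψ := by
  obtain ⟨v, huv⟩ := hu.exists_left_inv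
  obtain ⟨χ, hχ⟩ := exists_heckeToTwisted L hμ₁ hμ₂ huv
  constructor
  · have h1 : χ.comp ψ = (formalDemazureAlgebra L (hyperbolicFGL μ₁ μ₂)).val := by
      refine demazureAlgHom_ext L fun i => ?_
      rw [AlgHom.comp_apply, hψ, heckeDemazure, map_smul, map_add, hχ, AlgHom.commutes,
        Algebra.algebraMap_eq_smul_one, sub_add_cancel, smul_smul, mul_comm, huv, one_smul]
      rfl
    refine Function.Injective.of_comp (f := χ) ?_
    rw [← AlgHom.coe_comp, h1]
    exact Subtype.val_injective
  · rw [← AlgHom.range_eq_top, ← top_le_iff, ← adjoin_range_heckeT, Algebra.adjoin_le_iff]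
    rintro _ ⟨i, rfl⟩
    have h1 : heckeT D R i = ψ (v • demazureGen L (hyperbolicFGL μ₁ μ₂) i -
        algebraMap R _ (tElt R)) := by
      rw [map_sub, map_smul, hψ, AlgHom.commutes, heckeDemazure, smul_smul, huv, one_smul,
        add_sub_cancel_right]
    rw [h1]
    exact ⟨_, rfl⟩

end Comparison

end FormalDemazure

end

theorem theorem5p2 {k h : Type*} [Field k] [CharZero k] [AddCommGroup h] [Module k h]
    {l : ℕ} {A : Matrix (Fin l) (Fin l) ℤ} (D : FormalDemazure.KacMoodyRealization k h A)
    (L : FormalDemazure.FormalDemazureLattice D)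
    {R : Type*} [CommRing R] [Algebra (LaurentPolynomial ℤ) R]
    (hR : Function.Injective (algebraMap (LaurentPolynomial ℤ) R))
    (u μ₁ μ₂ : R) (hμ₁ : μ₁ = u * (FormalDemazure.tElt R + FormalDemazure.tInv R))
    (hμ₂ : μ₂ = -u ^ 2) :
    ∃ ψ : FormalDemazure.formalDemazureAlgebra L (FormalDemazure.hyperbolicFGL μ₁ μ₂) →ₐ[R]
        FormalDemazure.HeckeAlgebra D R,
      (∀ i, ψ (FormalDemazure.demazureGen L (FormalDemazure.hyperbolicFGL μ₁ μ₂) i) =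
        u • (FormalDemazure.heckeT D R i +
          algebraMap R (FormalDemazure.HeckeAlgebra D R) (FormalDemazure.tElt R))) ∧
      (∀ φ : FormalDemazure.formalDemazureAlgebra L (FormalDemazure.hyperbolicFGL μ₁ μ₂) →ₐ[R]
          FormalDemazure.HeckeAlgebra D R,
        (∀ i, φ (FormalDemazure.demazureGen L (FormalDemazure.hyperbolicFGL μ₁ μ₂) i) =
          u • (FormalDemazure.heckeT D R i +
            algebraMap R (FormalDemazure.HeckeAlgebra D R) (FormalDemazure.tElt R))) → φ = ψ) ∧
      (IsUnit u → Function.Bijective ψ) := by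
  obtain ⟨ψ, hψ⟩ := FormalDemazure.exists_demazureToHecke L hμ₁ hμ₂
  exact ⟨ψ, hψ, fun φ hφ => FormalDemazure.demazureAlgHom_ext L fun i => (hφ i).trans (hψ i).symm,
    fun hu => FormalDemazure.bijective_demazureToHecke L hμ₁ hμ₂ hu ψ hψ⟩
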